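/- **Setting.** Let $\nu$ be Lebesgue measure on $\mathbb{R}^2$. For $A,B\subset\mathbb{R}^2$ put $\check A=\{-a: a\in A\}$, $A\oplus B=\{a+b: a\in A,\ b\in B\}$, $A\ominus B=\{x: x+\check B\subset A\}$, and write $A^\circ$ for the interior and $A^c$ for the complement of $A$. Closed subsets of $\mathbb{R}^2$ carry the Borel $\sigma$-algebra of the topology generated by the families $\{F: F\cap K=\emptyset\}$ ($K$ compact) and $\{F: F\cap G\neq\emptyset\}$ ($G$ open). Let $X$ be a random closed set of the plane such that * $E\,\nu(X\oplus K)<\infty$ for every compact $K$; * $E\,\nu(X\ominus D)>0$ for some closed disk $D$ of positive radius; * almost surely $X=\overline{X^\circ}$. Let $\{(x_i,t_i)\}_{i}$ be a homogeneous Poisson point process of intensity one in $\mathbb{R}^2\times\mathbb{R}$, and let $(X_i)$ be i.i.d. random closed sets with the law of $X$, independent of this process. The visible parts of the dead leaves model with grain $X$ are, for $t_i\le 0$, $$V_i=(x_i+X_i)\setminus\bigcup_{t_j\in(t_i,0)}(x_j+X_j^\circ).$$ **Proposition.** Let $n\ge 1$ and let $K_1,\dots,K_n\subset\mathbb{R}^2$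 be non-empty compact sets. Put $\underline K_j=\bigcup_{k\le j}K_k$, with $\underline K_0=\emptyset$ and $\underline{\check K}_j=\bigcup_{k\le j}\check K_k$. Then $$\{\exists\, t_{i_1}<\dots<t_{i_n}\le 0:\ K_1\subset V_{i_1}^\circ,\dots,K_n\subset V_{i_n}^\circ\}$$ is an event (up to a null set), and its probability $Q^{(n)}(K_1,\dots,K_n)$ is $$Q^{(n)}(K_1,\dots,K_n)=\frac{F_X^{(n)}(K_1,\dots,K_n)}{G_X^{(n)}(K_1,\dots,K_n)},$$ where $$F_X^{(n)}(K_1,\dots,K_n)=\prod_{j=1}^{n}E\,\nu\big((X^\circ\ominus\check K_j)\cap(X\oplus\underline{\check K}_{j-1})^c\big),\qquad G_X^{(n)}(K_1,\dots,K_n)=\prod_{j=1}^{n}E\,\nu\big(X\oplus\underline{\check K}_{j}\big).$$ In particular, for every non-empty compact $K$, the probability $Q(K)$ that $K\subset V_i^\circ$ for some $t_i\le 0$ is $$Q(K)=\frac{E\,\nu(X^\circ\ominus\check K)}{E\,\nu(X\oplus\check K)}.$$ -/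

import Mathlib

open MeasureTheory ProbabilityTheory TopologicalSpace Set
open scoped Pointwise ENNReal

noncomputable section

namespace DeadLeaves

/-- The Euclidean plane; `volume` on it is the Lebesgue measure `ν`. -/
abbrev Plane : Type := EuclideanSpace ℝ (Fin 2)

/-- The hit-or-miss topology on the closed sets of the plane: it is generated by the families
`{F | F ∩ K = ∅}` for `K` compact and `{F | F ∩ G ≠ ∅}` for `G` open. -/
@[reducible]
def hitMissTopology : TopologicalSpace (Closeds Plane) :=
  TopologicalSpace.generateFrom
    ({U | ∃ K : Set Plane, IsCompact K ∧ U = {F : Closeds Plane | (F : Set Plane) ∩ K = ∅}} ∪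
      {U | ∃ G : Set Plane, IsOpen G ∧ U = {F : Closeds Plane | ((F : Set Plane) ∩ G).Nonempty}})

/-- The Borel σ-algebra of the hit-or-miss topology. A random closed set is a measurable map
into `Closeds Plane`. -/
instance instMeasurableSpaceCloseds : MeasurableSpace (Closeds Plane) :=
  @borel (Closeds Plane) hitMissTopology

/-- `A ⊖ B = {x | x + (-B) ⊆ A}`. The sum `A ⊕ B` is the pointwise sum `A + B` and the
reflected set of `A` is the pointwise negation `-A`. -/
def minkowskiDiff (A B : Set Plane) : Set Plane :=
  {x | x +ᵥ (-B) ⊆ A}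

/-- The points `z 0, z 1, …` (counted with multiplicity) form a Poisson point process with
intensity measure `μ`: the numbers of points in pairwise disjoint measurable sets of finite
`μ`-measure are independent Poisson variables whose means are the `μ`-measures of the sets. -/
structure IsPoissonPointProcess {Ω E : Type*} [MeasurableSpace Ω] [MeasurableSpace E]
    (z : ℕ → Ω → E) (μ : Measure E) (P : Measure Ω) : Prop where
  measurable : ∀ i, Measurable (z i)
  joint_law : ∀ (m : ℕ) (B : Fin m → Set E), (∀ j, MeasurableSet (B j)) →
    Pairwise (fun j k => Disjoint (B j) (B k)) → (∀ j, μ (B j) ≠ ∞) → ∀ k : Fin m → ℕ,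
      P {ω | ∀ j, {i | z i ω ∈ B j}.encard = (k j : ℕ∞)} =
        ∏ j, poissonMeasure (μ (B j)).toNNReal {k j}

/-- The random input `(xᵢ, tᵢ, Xᵢ)` of the dead leaves model with grain `X`: the points
`(xᵢ, tᵢ)` form a Poisson process of intensity one in `ℝ² × ℝ`, and the `Xᵢ` are independent
copies of `X`, independent of these points. -/
structure IsMarkedProcess {Ω Ω' : Type*} [MeasurableSpace Ω] [MeasurableSpace Ω']
    (x : ℕ → Ω → Plane) (t : ℕ → Ω → ℝ) (Xs : ℕ → Ω → Closeds Plane) (P : Measure Ω)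
    (X : Ω' → Closeds Plane) (P' : Measure Ω') : Prop where
  poisson : IsPoissonPointProcess (fun i ω => (x i ω, t i ω)) volume P
  measurable_grain : ∀ i, Measurable (Xs i)
  iIndep_grain : iIndepFun Xs P
  identDistrib_grain : ∀ i, IdentDistrib (Xs i) X P P'
  indep : IndepFun (fun ω i => (x i ω, t i ω)) (fun ω i => Xs i ω) P

/-- The visible part `Vᵢ = (xᵢ + Xᵢ) \ ⋃_{tⱼ ∈ (tᵢ, 0)} (xⱼ + interior Xⱼ)`. -/
def visiblePart (x : ℕ → Plane) (t : ℕ → ℝ) (X : ℕ → Closeds Plane) (i : ℕ) : Set Plane :=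
  (x i +ᵥ (X i : Set Plane)) \
    ⋃ j ∈ {j : ℕ | t j ∈ Ioo (t i) 0}, (x j +ᵥ interior (X j : Set Plane))

/-- The event that `K₁, …, Kₙ` lie in the interiors of visible parts of leaves with times
`t_{i₁} < ⋯ < t_{iₙ} ≤ 0`. -/
def sequentialEvent {Ω : Type*} (x : ℕ → Ω → Plane) (t : ℕ → Ω → ℝ)
    (Xs : ℕ → Ω → Closeds Plane) {n : ℕ} (K : Fin n → Set Plane) : Set Ω :=
  {ω | ∃ i : Fin n → ℕ, StrictMono (fun j => t (i j) ω) ∧ (∀ j, t (i j) ω ≤ 0) ∧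
    ∀ j, K j ⊆ interior
      (visiblePart (fun l => x l ω) (fun l => t l ω) (fun l => Xs l ω) (i j))}

/-- The event that `K` lies in the interior of a visible part of a leaf with time `≤ 0`. -/
def inclusionEvent {Ω : Type*} (x : ℕ → Ω → Plane) (t : ℕ → Ω → ℝ)
    (Xs : ℕ → Ω → Closeds Plane) (K : Set Plane) : Set Ω :=
  {ω | ∃ i : ℕ, t i ω ≤ 0 ∧ K ⊆ interior
      (visiblePart (fun l => x l ω) (fun l => t l ω) (fun l => Xs l ω) i)}

/-- `F_X^{(n)}(K₁, …, Kₙ) = ∏ⱼ E ν((X° ⊖ Ǩⱼ) ∩ (X ⊕ (Ǩ₁ ∪ ⋯ ∪ Ǩⱼ₋₁))ᶜ)`; for `j = 1` the union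
is empty and the factor is `E ν(X° ⊖ Ǩ₁)`. -/
def numerator {Ω' : Type*} [MeasurableSpace Ω'] (X : Ω' → Closeds Plane) (P' : Measure Ω')
    {n : ℕ} (K : Fin n → Set Plane) : ℝ≥0∞ :=
  ∏ j, ∫⁻ ω, volume (minkowskiDiff (interior (X ω : Set Plane)) (-(K j)) ∩
    ((X ω : Set Plane) + -(⋃ k ∈ Iio j, K k))ᶜ) ∂P'

/-- `G_X^{(n)}(K₁, …, Kₙ) = ∏ⱼ E ν(X ⊕ (Ǩ₁ ∪ ⋯ ∪ Ǩⱼ))`. -/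
def denominator {Ω' : Type*} [MeasurableSpace Ω'] (X : Ω' → Closeds Plane) (P' : Measure Ω')
    {n : ℕ} (K : Fin n → Set Plane) : ℝ≥0∞ :=
  ∏ j, ∫⁻ ω, volume ((X ω : Set Plane) + -(⋃ k ∈ Iic j, K k)) ∂P'

end DeadLeaves

end

/-!
The leaves `(xᵢ, tᵢ, Xᵢ)` form a Poisson process with intensity `dt ⊗ ρ`, where
`ρ = ν ⊗ law of X` measures the pairs (position, grain). Put

* `H j`: the leaf meets `K₀ ∪ ⋯ ∪ Kⱼ`, so that `ρ (H j) = E ν(X ⊕ (Ǩ₀ ∪ ⋯ ∪ Ǩⱼ))` (`measure_hitSet`);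
* `A j ⊆ H j`: the interior of the leaf contains `Kⱼ` and the leaf avoids `K₀ ∪ ⋯ ∪ Kⱼ₋₁`, so that
  `ρ (A j)` is the `j`-th factor of the numerator (`measure_coverSet_diff_hitSet`).

Almost surely only finitely many leaves meet a bounded region in bounded time and every grain is the
closure of its interior, so the interior of a visible part is the interior of its leaf minus the
later leaves (`interior_visiblePart`). The event then says that, going back from time `0`, the first
leaf in `H (n - 1)` lies in `A (n - 1)`, the next leaf in `H (n - 2)` lies in `A (n - 2)`, and so on
down to `H 0` (`backwardChain`, `backwardChain_iff_exists`). Each step succeeds, independently of the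
others, with probability `ρ (A j) / ρ (H j)`.

To compute with the discrete notion of a first success, time is cut into slabs of width `h`. In the
slab picture (`slabPattern`) a step is a first passage in independent trials, with probability
`(e^{-h(c-a)} - e^{-hc}) / (1 - e^{-hc})` for `a = ρ (A j)`, `c = ρ (H j)`, which tends to `a / c` as
`h → 0`; the slab events converge to the chain event almost surely, because no two leaves of
different kinds share their time (`HasPoissonVoids.measure_backwardChain`).

All of this uses the process of leaves only through its void probabilities and local finiteness
(`HasPoissonVoids`): void events of disjoint regions are independent, and they generate the needed
σ-algebras. The void probabilities come from the generating functional
`E ∏ᵢ (1 - f (zᵢ)) = exp (-∫ f)` of the unmarked process, with `f (z)` the probability that a leaf at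
`z` falls into the region (`measure_forall_notMem_marked`).
-/

namespace DeadLeaves

open Filter Topology

/-! ### Counts of a Poisson process -/

/-- The probability generating function of a Poisson variable. -/
theorem lintegral_pow_poissonMeasure (r : NNReal) {c : ℝ≥0∞} (hc : c ≤ 1) :
    ∫⁻ k, (1 - c) ^ k ∂poissonMeasure r = ENNReal.ofReal (Real.exp (-(r * c.toReal))) := by
  have hct : c ≠ ∞ := ne_top_of_le_ne_top ENNReal.one_ne_top hc
  have hc1 : c.toReal ≤ 1 := by simpa using ENNReal.toReal_mono ENNReal.one_ne_top hc
  have hs : 1 - c = ENNReal.ofReal (1 - c.toReal) := by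
    rw [ENNReal.ofReal_sub _ ENNReal.toReal_nonneg, ENNReal.ofReal_toReal hct, ENNReal.ofReal_one]
  rw [hs, poissonMeasure, lintegral_sum_measure]
  have h0 : (0 : ℝ) ≤ 1 - c.toReal := by linarith
  have hsum := (NormedSpace.expSeries_div_hasSum_exp ((r : ℝ) * (1 - c.toReal))).mul_left
    (Real.exp (-(r : ℝ)))
  rw [← Real.exp_eq_exp_ℝ, ← Real.exp_add] at hsum
  have hterm : ∀ n : ℕ, ∫⁻ k, ENNReal.ofReal (1 - c.toReal) ^ k
      ∂(ENNReal.ofReal (Real.exp (-(r : ℝ)) * (r : ℝ) ^ n / (n.factorial : ℝ)) •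
        Measure.dirac n) =
      ENNReal.ofReal (Real.exp (-(r : ℝ)) *
        (((r : ℝ) * (1 - c.toReal)) ^ n / (n.factorial : ℝ))) := by
    intro n
    rw [lintegral_smul_measure, lintegral_dirac, smul_eq_mul, ← ENNReal.ofReal_pow h0,
      ← ENNReal.ofReal_mul (by positivity)]
    congr 1
    rw [mul_pow]
    ring
  simp_rw [hterm]
  rw [← ENNReal.ofReal_tsum_of_nonneg (fun n => by positivity) hsum.summable, hsum.tsum_eq]
  congr 2
  ring

section Poisson

variable {Ω E : Type*} [MeasurableSpace Ω] [MeasurableSpace E]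
  {z : ℕ → Ω → E} {μ : Measure E} {P : Measure Ω}

theorem measurableSet_encard_eq (hz : ∀ i, Measurable (z i)) {B : Set E} (hB : MeasurableSet B)
    (k : ℕ∞) : MeasurableSet {ω | {i | z i ω ∈ B}.encard = k} := by
  have h : ∀ ω, (({i | z i ω ∈ B}.encard : ℕ∞) : ℝ≥0∞) =
      ∑' i, (z i ⁻¹' B).indicator (1 : Ω → ℝ≥0∞) ω := by
    intro ω
    rw [← ENNReal.tsum_set_one, tsum_subtype {i | z i ω ∈ B} (fun _ => (1 : ℝ≥0∞))]
    rfl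
  have hm : Measurable (fun ω => ∑' i, (z i ⁻¹' B).indicator (1 : Ω → ℝ≥0∞) ω) :=
    Measurable.tsum fun i => measurable_one.indicator (hz i hB)
  have := hm (measurableSet_singleton (k : ℝ≥0∞))
  convert this using 1
  ext ω
  simp only [mem_ofPred_eq, mem_preimage, mem_singleton_iff, ← h]
  exact ENat.toENNReal_inj.symm

namespace IsPoissonPointProcess

theorem measure_encard_eq (hz : IsPoissonPointProcess z μ P) {B : Set E} (hB : MeasurableSet B)
    (hμ : μ B ≠ ∞) (k : ℕ) :
    P {ω | {i | z i ω ∈ B}.encard = k} = poissonMeasure (μ B).toNNReal {k} := by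
  have := hz.joint_law 1 (fun _ => B) (fun _ => hB)
    (fun i j hij => (hij (Subsingleton.elim i j)).elim) (fun _ => hμ) (fun _ => k)
  simpa using this

theorem ae_finite [IsProbabilityMeasure P] (hz : IsPoissonPointProcess z μ P) {B : Set E}
    (hB : MeasurableSet B) (hμ : μ B ≠ ∞) : ∀ᵐ ω ∂P, {i | z i ω ∈ B}.Finite := by
  have hm := fun k : ℕ => measurableSet_encard_eq hz.measurable hB (k : ℕ∞)
  have h1 : P (⋃ k : ℕ, {ω | {i | z i ω ∈ B}.encard = k}) = 1 := by
    rw [measure_iUnion _ hm]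
    · simp_rw [hz.measure_encard_eq hB hμ]
      rw [← measure_iUnion (fun i j hij => by simpa using hij)
        (fun i => measurableSet_singleton i)]
      rw [show (⋃ i : ℕ, ({i} : Set ℕ)) = univ by ext; simp]
      exact measure_univ
    · intro i j hij
      refine Set.disjoint_left.2 fun ω h h' => hij ?_
      simp only [mem_ofPred_eq] at h h'
      exact_mod_cast h.symm.trans h'
  have h2 := (prob_compl_eq_zero_iff (MeasurableSet.iUnion hm)).2 h1
  rw [← mem_ae_iff] at h2
  filter_upwards [h2] with ω hω
  obtain ⟨k, hk⟩ := mem_iUnion.1 hω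
  exact Set.finite_of_encard_eq_coe hk

/-- The numbers of points in finitely many pairwise disjoint sets of finite measure are
independent, so the joint generating function is the product of the Poisson ones. -/
theorem lintegral_prod_pow [IsProbabilityMeasure P] (hz : IsPoissonPointProcess z μ P) {m : ℕ}
    {B : Fin m → Set E} (hB : ∀ j, MeasurableSet (B j))
    (hd : Pairwise (fun j k => Disjoint (B j) (B k))) (hμ : ∀ j, μ (B j) ≠ ∞)
    {c : Fin m → ℝ≥0∞} (hc : ∀ j, c j ≤ 1) :
    ∫⁻ ω, ∏ j, (1 - c j) ^ {i | z i ω ∈ B j}.ncard ∂P =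
      ∏ j, ENNReal.ofReal (Real.exp (-((μ (B j)).toReal * (c j).toReal))) := by
  set N : Fin m → Ω → ℕ := fun j ω => {i | z i ω ∈ B j}.ncard with hN
  have hfin : ∀ j, ∀ᵐ ω ∂P, {i | z i ω ∈ B j}.Finite := fun j => hz.ae_finite (hB j) (hμ j)
  have hNm : ∀ j, Measurable (N j) := by
    intro j
    refine measurable_to_countable' fun k => ?_
    have : N j ⁻¹' {k} = {ω | ENat.toNat {i | z i ω ∈ B j}.encard = k} := rfl
    rw [this]
    have h2 : {ω | ENat.toNat {i | z i ω ∈ B j}.encard = k} =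
        ⋃ e ∈ {e : ℕ∞ | e.toNat = k}, {ω | {i | z i ω ∈ B j}.encard = e} := by
      ext ω; simp
    rw [h2]
    exact MeasurableSet.biUnion (to_countable _)
      fun e _ => measurableSet_encard_eq hz.measurable (hB j) e
  have hiff : ∀ᵐ ω ∂P, ∀ j, ∀ k : ℕ, N j ω = k ↔ {i | z i ω ∈ B j}.encard = k := by
    filter_upwards [ae_all_iff.2 hfin] with ω hω j k
    rw [← (hω j).cast_ncard_eq]
    simp [hN]
  have hmap : ∀ j, P.map (N j) = poissonMeasure (μ (B j)).toNNReal := by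
    intro j
    refine Measure.ext_of_singleton fun k => ?_
    rw [Measure.map_apply (hNm j) (measurableSet_singleton k), ← hz.measure_encard_eq (hB j) (hμ j)]
    refine measure_congr ?_
    filter_upwards [hiff] with ω hω
    exact propext (hω j k)
  have hind : iIndepFun N P := by
    rw [iIndepFun_iff_map_fun_eq_pi_map (fun j => (hNm j).aemeasurable)]
    refine Measure.ext_of_singleton fun k => ?_
    rw [Measure.map_apply (measurable_pi_lambda _ hNm) (measurableSet_singleton k),
      Measure.pi_singleton]
    simp_rw [hmap]
    rw [← hz.joint_law m B hB hd hμ k]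
    refine measure_congr ?_
    filter_upwards [hiff] with ω hω
    refine propext ?_
    change (fun j => N j ω) = k ↔ ∀ j, _
    rw [funext_iff]
    exact forall_congr' fun j => hω j (k j)
  rw [lintegral_prod_eq_prod_lintegral_of_indepFun Finset.univ
    (fun j ω => (1 - c j) ^ N j ω)
    (hind.comp (fun j k => (1 - c j) ^ k) fun j => measurable_of_countable _)
    (fun j => (measurable_of_countable (fun k : ℕ => (1 - c j) ^ k)).comp (hNm j))]
  refine Finset.prod_congr rfl fun j _ => ?_
  rw [← lintegral_map (μ := P) (g := N j) (f := fun k : ℕ => (1 - c j) ^ k)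
    (measurable_of_countable _) (hNm j), hmap, lintegral_pow_poissonMeasure _ (hc j)]
  rfl

end IsPoissonPointProcess

end Poisson

/-! ### Generating functional and void probabilities -/

section Functional

variable {Ω E : Type*} [MeasurableSpace Ω] [MeasurableSpace E]
  {z : ℕ → Ω → E} {μ : Measure E} {P : Measure Ω}

theorem antitone_prod_range_one_sub (a : ℕ → ℝ≥0∞) :
    Antitone fun n => ∏ i ∈ Finset.range n, (1 - a i) := by
  refine antitone_nat_of_succ_le fun n => ?_
  rw [Finset.prod_range_succ]
  exact mul_le_of_le_one_right' tsub_le_self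

theorem prod_one_sub_le_one (s : Finset ℕ) (a : ℕ → ℝ≥0∞) : ∏ i ∈ s, (1 - a i) ≤ 1 :=
  Finset.prod_le_one' fun _ _ => tsub_le_self

namespace IsPoissonPointProcess

/-- The generating functional for a simple function: the product over the points only depends on the
numbers of points in the level sets, which are independent Poisson variables. -/
theorem lintegral_iInf_prod_simpleFunc [IsProbabilityMeasure P] (hz : IsPoissonPointProcess z μ P)
    (φ : SimpleFunc E ℝ≥0∞) (hφ : ∀ e, φ e ≤ 1) (hfin : ∫⁻ e, φ e ∂μ ≠ ∞) :
    ∫⁻ ω, ⨅ n, ∏ i ∈ Finset.range n, (1 - φ (z i ω)) ∂P =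
      ENNReal.ofReal (Real.exp (-(∫⁻ e, φ e ∂μ).toReal)) := by
  classical
  set s : Finset ℝ≥0∞ := φ.range.filter (· ≠ 0) with hs
  let e := s.equivFin.symm
  let B : Fin s.card → Set E := fun j => φ ⁻¹' {(e j : ℝ≥0∞)}
  have hB : ∀ j, MeasurableSet (B j) := fun j => φ.measurableSet_fiber _
  have hd : Pairwise (fun j k => Disjoint (B j) (B k)) := by
    intro j k hjk
    refine Set.disjoint_left.2 fun x hx hx' => hjk (e.injective (Subtype.ext ?_))
    exact (mem_singleton_iff.1 hx).symm.trans (mem_singleton_iff.1 hx')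
  have hs0 : ∀ c ∈ s, c ≠ 0 := fun c hc => (Finset.mem_filter.1 hc).2
  have hs1 : ∀ c ∈ s, c ≤ 1 := by
    intro c hc
    obtain ⟨x, rfl⟩ := SimpleFunc.mem_range.1 (Finset.mem_filter.1 hc).1
    exact hφ x
  have hlin : ∫⁻ e, φ e ∂μ = ∑ c ∈ s, c * μ (φ ⁻¹' {c}) := by
    rw [SimpleFunc.lintegral_eq_lintegral, SimpleFunc.lintegral, hs, Finset.sum_filter]
    refine Finset.sum_congr rfl fun c _ => ?_
    split_ifs with h
    · rfl
    · rw [not_not.1 h, zero_mul]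
  have hμs : ∀ c ∈ s, μ (φ ⁻¹' {c}) ≠ ∞ := by
    intro c hc h
    refine hfin ?_
    rw [hlin, ENNReal.sum_eq_top]
    exact ⟨c, hc, by rw [h, ENNReal.mul_top (hs0 c hc)]⟩
  have hμ : ∀ j, μ (B j) ≠ ∞ := fun j => hμs _ (e j).2
  have key := hz.lintegral_prod_pow hB hd hμ (c := fun j => (e j : ℝ≥0∞))
    (fun j => hs1 _ (e j).2)
  have hfinite : ∀ᵐ ω ∂P, ∀ j, {i | z i ω ∈ B j}.Finite :=
    ae_all_iff.2 fun j => hz.ae_finite (hB j) (hμ j)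
  have hprod : ∀ᵐ ω ∂P, ⨅ n, ∏ i ∈ Finset.range n, (1 - φ (z i ω)) =
      ∏ j, (1 - (e j : ℝ≥0∞)) ^ {i | z i ω ∈ B j}.ncard := by
    filter_upwards [hfinite] with ω hω
    have hS : {i | φ (z i ω) ≠ 0}.Finite := by
      refine (finite_iUnion hω).subset fun i hi => mem_iUnion.2 ?_
      refine ⟨s.equivFin ⟨φ (z i ω), ?_⟩, ?_⟩
      · exact Finset.mem_filter.2 ⟨SimpleFunc.mem_range_self _ _, hi⟩
      · simp [B, e]
    set S := hS.toFinset with hSdef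
    have hSmem : ∀ i, i ∈ S ↔ φ (z i ω) ≠ 0 := fun i => by simp [hSdef]
    have h1 : ⨅ n, ∏ i ∈ Finset.range n, (1 - φ (z i ω)) = ∏ i ∈ S, (1 - φ (z i ω)) := by
      refine le_antisymm ?_ ?_
      · obtain ⟨n, hn⟩ := S.exists_nat_subset_range
        refine (iInf_le _ n).trans (le_of_eq ?_)
        refine (Finset.prod_subset hn fun i _ hi => ?_).symm
        rw [hSmem, not_not] at hi
        rw [hi, tsub_zero]
      · refine le_iInf fun n => ?_
        have h2 : ∏ i ∈ Finset.range n, (1 - φ (z i ω)) =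
            ∏ i ∈ Finset.range n with i ∈ S, (1 - φ (z i ω)) := by
          rw [Finset.prod_filter]
          refine Finset.prod_congr rfl fun i _ => ?_
          split_ifs with h
          · rfl
          · rw [hSmem, not_not] at h
            rw [h, tsub_zero]
        rw [h2]
        have h3 : (Finset.range n).filter (· ∈ S) ⊆ S := fun i hi => (Finset.mem_filter.1 hi).2
        rw [← Finset.prod_sdiff h3]
        exact mul_le_of_le_one_left' (prod_one_sub_le_one _ _)
    have h4 : ∏ i ∈ S, (1 - φ (z i ω)) =
        ∏ c ∈ s, ∏ i ∈ S with φ (z i ω) = c, (1 - φ (z i ω)) := by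
      refine (Finset.prod_fiberwise_of_maps_to (fun i hi => ?_) _).symm
      exact Finset.mem_filter.2 ⟨SimpleFunc.mem_range_self _ _, (hSmem i).1 hi⟩
    rw [h1, h4, ← Finset.prod_coe_sort s, ← e.prod_comp]
    refine Finset.prod_congr rfl fun j _ => ?_
    rw [Finset.prod_congr rfl (g := fun _ => 1 - (e j : ℝ≥0∞))
      (fun i hi => by rw [(Finset.mem_filter.1 hi).2]), Finset.prod_const]
    congr 1
    rw [← Set.ncard_coe_finset]
    congr 1
    ext i
    have := hs0 _ (e j).2
    simp only [Finset.coe_filter, hSmem, mem_ofPred_eq, B, mem_preimage, mem_singleton_iff]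
    constructor
    · exact fun h => h.2
    · exact fun h => ⟨h ▸ this, h⟩
  rw [lintegral_congr_ae hprod, key, ← ENNReal.ofReal_prod_of_nonneg fun _ _ => (Real.exp_pos _).le,
    ← Real.exp_sum, hlin, ENNReal.toReal_sum, Finset.sum_neg_distrib]
  · congr 3
    rw [← Finset.sum_coe_sort s, ← e.sum_comp]
    refine Finset.sum_congr rfl fun j _ => ?_
    rw [ENNReal.toReal_mul, mul_comm]
  · intro c hc
    exact ENNReal.mul_ne_top (ne_top_of_le_ne_top ENNReal.one_ne_top (hs1 c hc)) (hμs c hc)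

/-- The probability generating functional of a Poisson process: for `0 ≤ f ≤ 1` integrable,
`E ∏ᵢ (1 - f (zᵢ)) = exp (-∫ f dμ)`. The infinite product is written as the infimum of its
decreasing partial products. -/
theorem lintegral_iInf_prod [IsProbabilityMeasure P] (hz : IsPoissonPointProcess z μ P)
    {f : E → ℝ≥0∞} (hf : Measurable f) (hf1 : ∀ e, f e ≤ 1) (hfin : ∫⁻ e, f e ∂μ ≠ ∞) :
    ∫⁻ ω, ⨅ n, ∏ i ∈ Finset.range n, (1 - f (z i ω)) ∂P =
      ENNReal.ofReal (Real.exp (-(∫⁻ e, f e ∂μ).toReal)) := by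
  set φ := SimpleFunc.eapprox f with hφ
  have hle : ∀ m e, φ m e ≤ f e := fun m e => by
    rw [← SimpleFunc.iSup_eapprox_apply hf e]
    exact le_iSup (fun m => φ m e) m
  have hint : ∀ m, ∫⁻ e, φ m e ∂μ ≤ ∫⁻ e, f e ∂μ := fun m => lintegral_mono (hle m)
  have hsimple := fun m => hz.lintegral_iInf_prod_simpleFunc (φ m)
    (fun e => (hle m e).trans (hf1 e)) (ne_top_of_le_ne_top hfin (hint m))
  have hlim : Tendsto (fun m => ENNReal.ofReal (Real.exp (-(∫⁻ e, φ m e ∂μ).toReal))) atTop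
      (𝓝 (ENNReal.ofReal (Real.exp (-(∫⁻ e, f e ∂μ).toReal)))) := by
    have h1 : Tendsto (fun m => ∫⁻ e, φ m e ∂μ) atTop (𝓝 (∫⁻ e, f e ∂μ)) :=
      lintegral_tendsto_of_tendsto_of_monotone (fun m => (φ m).measurable.aemeasurable)
        (ae_of_all _ fun e => fun m m' h => SimpleFunc.monotone_eapprox f h e)
        (ae_of_all _ fun e => SimpleFunc.tendsto_eapprox hf e)
    exact ENNReal.tendsto_ofReal ((Real.continuous_exp.tendsto _).comp
      ((ENNReal.tendsto_toReal hfin).comp h1).neg)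
  have hmeas : ∀ m, Measurable fun ω => ⨅ n, ∏ i ∈ Finset.range n, (1 - φ m (z i ω)) := fun m =>
    Measurable.iInf fun n => Finset.measurable_prod _ fun i _ =>
      ((φ m).measurable.comp (hz.measurable i)).const_sub 1
  have hanti : Antitone fun m ω => ⨅ n, ∏ i ∈ Finset.range n, (1 - φ m (z i ω)) := by
    intro m m' h ω
    refine iInf_mono fun n => Finset.prod_le_prod' fun i _ => ?_
    exact tsub_le_tsub_left (SimpleFunc.monotone_eapprox f h _) _
  have hInf : ∀ ω, ⨅ n, ∏ i ∈ Finset.range n, (1 - f (z i ω)) =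
      ⨅ m, ⨅ n, ∏ i ∈ Finset.range n, (1 - φ m (z i ω)) := by
    intro ω
    rw [iInf_comm]
    refine iInf_congr fun n => ?_
    have ht : Tendsto (fun m => ∏ i ∈ Finset.range n, (1 - φ m (z i ω))) atTop
        (𝓝 (∏ i ∈ Finset.range n, (1 - f (z i ω)))) := by
      refine ENNReal.tendsto_finsetProd_of_ne_top _ (fun i _ => ?_) fun i _ =>
        ne_top_of_le_ne_top ENNReal.one_ne_top tsub_le_self
      exact ENNReal.Tendsto.sub tendsto_const_nhds (SimpleFunc.tendsto_eapprox hf _)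
        (Or.inl ENNReal.one_ne_top)
    have ha : Antitone fun m => ∏ i ∈ Finset.range n, (1 - φ m (z i ω)) := fun m m' h =>
      Finset.prod_le_prod' fun i _ => tsub_le_tsub_left (SimpleFunc.monotone_eapprox f h _) _
    exact tendsto_nhds_unique ht (tendsto_atTop_iInf ha)
  simp_rw [hInf]
  have h0 : ∫⁻ ω, ⨅ n, ∏ i ∈ Finset.range n, (1 - φ 0 (z i ω)) ∂P ≠ ∞ := by
    rw [hsimple]; exact ENNReal.ofReal_ne_top
  rw [lintegral_iInf hmeas hanti h0]
  have ha2 : Antitone fun m => ∫⁻ ω, ⨅ n, ∏ i ∈ Finset.range n, (1 - φ m (z i ω)) ∂P :=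
    fun m m' h => lintegral_mono (hanti h)
  refine tendsto_nhds_unique (tendsto_atTop_iInf ha2) ?_
  simp_rw [hsimple]
  exact hlim

end IsPoissonPointProcess

/-- The void probabilities of an independently marked Poisson process: if the marks `Yᵢ` are
independent with law `Q` and independent of the points `zᵢ`, no pair `(zᵢ, Yᵢ)` lies in `B` with
probability `exp (-(μ ⊗ Q) B)`. Given the points, that probability is `∏ᵢ (1 - Q {y | (zᵢ, y) ∈ B})`,
so the generating functional gives the mean. -/
theorem measure_forall_notMem_marked {M : Type*} [MeasurableSpace M] [IsProbabilityMeasure P]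
    [SFinite μ]
    (hz : IsPoissonPointProcess z μ P) {Y : ℕ → Ω → M} {Q : Measure M} [IsProbabilityMeasure Q]
    (hY : ∀ i, Measurable (Y i)) (hYi : iIndepFun Y P) (hQ : ∀ i, P.map (Y i) = Q)
    (hzY : IndepFun (fun ω i => z i ω) (fun ω i => Y i ω) P) {B : Set (E × M)}
    (hB : MeasurableSet B) (hfin : μ.prod Q B ≠ ∞) :
    P {ω | ∀ i, (z i ω, Y i ω) ∉ B} = ENNReal.ofReal (Real.exp (-(μ.prod Q B).toReal)) := by
  set f : E → ℝ≥0∞ := fun e => Q (Prod.mk e ⁻¹' B) with hf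
  have hfm : Measurable f := measurable_measure_prodMk_left hB
  have hfint : ∫⁻ e, f e ∂μ = μ.prod Q B := (Measure.prod_apply hB).symm
  rw [← hfint, ← hz.lintegral_iInf_prod hfm (fun e => prob_le_one) (by rwa [hfint])]
  have hZm : Measurable fun ω i => z i ω := measurable_pi_lambda _ hz.measurable
  have hYm : Measurable fun ω i => Y i ω := measurable_pi_lambda _ hY
  have hpart : ∀ n, P {ω | ∀ i ∈ Finset.range n, (z i ω, Y i ω) ∉ B} =
      ∫⁻ ω, ∏ i ∈ Finset.range n, (1 - f (z i ω)) ∂P := by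
    intro n
    set A : Set ((ℕ → E) × (ℕ → M)) := {p | ∀ i ∈ Finset.range n, (p.1 i, p.2 i) ∉ B} with hA
    have hAm : MeasurableSet A := by
      have : A = ⋂ i ∈ Finset.range n, (fun p : (ℕ → E) × (ℕ → M) => (p.1 i, p.2 i)) ⁻¹' Bᶜ := by
        ext p; simp [hA]
      rw [this]
      exact Finset.measurableSet_biInter _ fun i _ =>
        (((measurable_pi_apply i).comp measurable_fst).prodMk
          ((measurable_pi_apply i).comp measurable_snd)) hB.compl
    have h1 : P {ω | ∀ i ∈ Finset.range n, (z i ω, Y i ω) ∉ B} =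
        P.map (fun ω => ((fun i => z i ω), (fun i => Y i ω))) A := by
      rw [Measure.map_apply (hZm.prodMk hYm) hAm]
      rfl
    have := Measure.isProbabilityMeasure_map (μ := P) hYm.aemeasurable
    rw [h1, hzY.map_prod_eq_prod_map_map hZm.aemeasurable hYm.aemeasurable,
      Measure.prod_apply hAm, lintegral_map (measurable_measure_prodMk_left hAm) hZm]
    refine lintegral_congr fun ω => ?_
    rw [Measure.map_apply hYm (measurable_prodMk_left hAm)]
    have h2 := hYi.measure_inter_preimage_eq_mul (Finset.range n)
      (sets := fun i => (Prod.mk (z i ω) ⁻¹' B)ᶜ)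
      (fun i _ => (measurable_prodMk_left hB).compl)
    have h3 : (fun ω i => Y i ω) ⁻¹' (Prod.mk (fun i => z i ω) ⁻¹' A) =
        ⋂ i ∈ Finset.range n, Y i ⁻¹' (Prod.mk (z i ω) ⁻¹' B)ᶜ := by
      ext ω'; simp [hA]
    rw [h3, h2]
    refine Finset.prod_congr rfl fun i _ => ?_
    rw [← Measure.map_apply (hY i) (measurable_prodMk_left hB).compl, hQ,
      prob_compl_eq_one_sub (measurable_prodMk_left hB)]
  have hset : {ω | ∀ i, (z i ω, Y i ω) ∉ B} =
      ⋂ n, {ω | ∀ i ∈ Finset.range n, (z i ω, Y i ω) ∉ B} := by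
    ext ω
    simp only [mem_ofPred_eq, mem_iInter, Finset.mem_range]
    exact ⟨fun h n i _ => h i, fun h i => h (i + 1) i (Nat.lt_succ_self i)⟩
  have hanti : Antitone fun n => {ω | ∀ i ∈ Finset.range n, (z i ω, Y i ω) ∉ B} :=
    fun n m hnm ω h i hi => h i (Finset.range_mono hnm hi)
  have hm : ∀ n, MeasurableSet {ω | ∀ i ∈ Finset.range n, (z i ω, Y i ω) ∉ B} := by
    intro n
    have : {ω | ∀ i ∈ Finset.range n, (z i ω, Y i ω) ∉ B} =
        ⋂ i ∈ Finset.range n, (fun ω => (z i ω, Y i ω)) ⁻¹' Bᶜ := by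
      ext ω; simp
    rw [this]
    exact Finset.measurableSet_biInter _ fun i _ =>
      ((hz.measurable i).prodMk (hY i)) hB.compl
  rw [hset, hanti.measure_iInter (fun n => (hm n).nullMeasurableSet) ⟨0, measure_ne_top _ _⟩,
    lintegral_iInf]
  · exact iInf_congr hpart
  · exact fun n => Finset.measurable_prod _ fun i _ =>
      (hfm.comp (hz.measurable i)).const_sub 1
  · exact fun n m hnm ω => antitone_prod_range_one_sub (fun i => f (z i ω)) hnm
  · simp

end Functional

/-! ### First-occurrence patterns in independent trials -/

section Trials

variable {Ω : Type*} {m𝓕 : ℕ → MeasurableSpace Ω}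

/-- The event that, looking at trials `m, m + 1, …`, some trial satisfies `W`, all trials before it
satisfy `V`, and the trials after it satisfy `R`. -/
def firstPassage (V W R : ℕ → Set Ω) (m : ℕ) : Set Ω :=
  {ω | ∃ k, (∀ l < k, ω ∈ V (m + l)) ∧ ω ∈ W (m + k) ∧ ω ∈ R (m + k + 1)}

theorem firstPassage_eq_iUnion (V W R : ℕ → Set Ω) (m : ℕ) :
    firstPassage V W R m =
      ⋃ k, (⋂ l ∈ Finset.range k, V (m + l)) ∩ (W (m + k) ∩ R (m + k + 1)) := by
  ext ω
  simp [firstPassage]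

theorem measurableSet_passage_after {V W R : ℕ → Set Ω}
    (hV : ∀ l, MeasurableSet[m𝓕 l] (V l)) (hW : ∀ l, MeasurableSet[m𝓕 l] (W l))
    (hR : ∀ m, MeasurableSet[⨆ l ∈ Ici m, m𝓕 l] (R m)) (k m : ℕ) :
    MeasurableSet[⨆ l ∈ Ici m, m𝓕 l]
      ((⋂ l ∈ Finset.range k, V (m + l)) ∩ (W (m + k) ∩ R (m + k + 1))) := by
  have hle : ∀ l, m ≤ l → m𝓕 l ≤ ⨆ l ∈ Ici m, m𝓕 l := fun l hl =>
    le_biSup m𝓕 (mem_Ici.2 hl)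
  refine MeasurableSet.inter (Finset.measurableSet_biInter _ fun l _ => ?_) (.inter ?_ ?_)
  · exact hle _ (Nat.le_add_right _ _) _ (hV _)
  · exact hle _ (Nat.le_add_right _ _) _ (hW _)
  · refine (biSup_mono (f := m𝓕) fun l hl => ?_ : _ ≤ ⨆ l ∈ Ici m, m𝓕 l) _ (hR _)
    have : m + k + 1 ≤ l := hl
    exact mem_Ici.2 (by omega)

theorem measurableSet_firstPassage {V W R : ℕ → Set Ω}
    (hV : ∀ l, MeasurableSet[m𝓕 l] (V l)) (hW : ∀ l, MeasurableSet[m𝓕 l] (W l))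
    (hR : ∀ m, MeasurableSet[⨆ l ∈ Ici m, m𝓕 l] (R m)) (m : ℕ) :
    MeasurableSet[⨆ l ∈ Ici m, m𝓕 l] (firstPassage V W R m) := by
  rw [firstPassage_eq_iUnion]
  exact MeasurableSet.iUnion fun k => measurableSet_passage_after hV hW hR k m

variable [mΩ : MeasurableSpace Ω] {P : Measure Ω}

theorem measure_inter_of_iIndep_tail (hle : ∀ l, m𝓕 l ≤ mΩ) (hind : iIndep m𝓕 P) {m : ℕ}
    {A B : Set Ω} (hA : MeasurableSet[m𝓕 m] A) (hB : MeasurableSet[⨆ l ∈ Ici (m + 1), m𝓕 l] B) :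
    P (A ∩ B) = P A * P B := by
  have h := indep_iSup_of_disjoint hle hind (S := {m}) (T := Ici (m + 1))
    (by simp)
  rw [iSup_singleton] at h
  exact (Indep_iff _ _ _).1 h A B hA hB

/-- If the trials are independent and `V` and `W` exclude each other, the first trial outside `V`
satisfies `W` with probability `∑ₖ qᵏ w = w / (1 - q)`, and what follows it is independent. -/
theorem measure_firstPassage (hle : ∀ l, m𝓕 l ≤ mΩ) (hind : iIndep m𝓕 P) {V W R : ℕ → Set Ω}
    (hV : ∀ l, MeasurableSet[m𝓕 l] (V l)) (hW : ∀ l, MeasurableSet[m𝓕 l] (W l))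
    (hR : ∀ m, MeasurableSet[⨆ l ∈ Ici m, m𝓕 l] (R m))
    (hVW : ∀ l, Disjoint (V l) (W l)) {q w r : ℝ≥0∞} (hq : ∀ l, P (V l) = q)
    (hw : ∀ l, P (W l) = w) (hr : ∀ m, P (R m) = r) (m : ℕ) :
    P (firstPassage V W R m) = (1 - q)⁻¹ * w * r := by
  set D : ℕ → ℕ → Set Ω := fun k m =>
    (⋂ l ∈ Finset.range k, V (m + l)) ∩ (W (m + k) ∩ R (m + k + 1)) with hD
  have hDm : ∀ k m, MeasurableSet[⨆ l ∈ Ici m, m𝓕 l] (D k m) :=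
    measurableSet_passage_after hV hW hR
  have hDP : ∀ k m, P (D k m) = q ^ k * (w * r) := by
    intro k
    induction k with
    | zero =>
      intro m
      have : D 0 m = W m ∩ R (m + 1) := by simp [hD]
      rw [this, measure_inter_of_iIndep_tail hle hind (hW m) (hR (m + 1)), hw, hr, pow_zero, one_mul]
    | succ k ih =>
      intro m
      have : D (k + 1) m = V m ∩ D k (m + 1) := by
        ext ω
        simp only [hD, mem_inter_iff, mem_iInter, Finset.mem_range]
        rw [show m + (k + 1) = m + 1 + k by ring, ← and_assoc (a := ω ∈ V m)]
        refine and_congr_left fun _ => ⟨fun h => ⟨h 0 (by omega), fun l hl => ?_⟩, fun h l hl => ?_⟩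
        · rw [show m + 1 + l = m + (l + 1) by ring]
          exact h (l + 1) (by omega)
        · rcases l with _ | l
          · exact h.1
          · rw [show m + (l + 1) = m + 1 + l by ring]
            exact h.2 l (by omega)
      rw [this, measure_inter_of_iIndep_tail hle hind (hV m) (hDm k (m + 1)), ih, hq, pow_succ]
      ring
  rw [firstPassage_eq_iUnion]
  change P (⋃ k, D k m) = _
  rw [measure_iUnion]
  · simp_rw [hDP]
    rw [ENNReal.tsum_mul_right, ENNReal.tsum_geometric, mul_assoc]
  · have key : ∀ i j, i < j → Disjoint (D i m) (D j m) := by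
      intro i j hij
      refine Set.disjoint_left.2 fun ω hi hj => ?_
      exact Set.disjoint_left.1 (hVW (m + i))
        (by simpa using mem_iInter₂.1 hj.1 i (Finset.mem_range.2 hij)) hi.2.1
    intro i j hij
    rcases lt_or_gt_of_ne hij with h | h
    · exact key i j h
    · exact (key j i h).symm
  · exact fun k => iSup₂_le (fun l _ => hle l) _ (hDm k m)

end Trials

/-! ### Void probabilities in time slabs -/

/-- Points `tᵢ` in time with marks `yᵢ` that are locally finite and have the void probabilities of
a Poisson process of intensity `dt ⊗ ρ`. Nothing else about the process enters the computation. -/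
structure HasPoissonVoids {Ω S : Type*} [MeasurableSpace Ω] [MeasurableSpace S]
    (t : ℕ → Ω → ℝ) (y : ℕ → Ω → S) (ρ : Measure S) (P : Measure Ω) : Prop where
  measurable_time : ∀ i, Measurable (t i)
  measurable_mark : ∀ i, Measurable (y i)
  measure_void : ∀ B : Set (ℝ × S), MeasurableSet B → (volume.prod ρ) B ≠ ∞ →
    P {ω | ∀ i, (t i ω, y i ω) ∉ B} = ENNReal.ofReal (Real.exp (-((volume.prod ρ) B).toReal))
  ae_finite : ∀ B : Set (ℝ × S), MeasurableSet B → (volume.prod ρ) B ≠ ∞ →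
    ∀ᵐ ω ∂P, {i | (t i ω, y i ω) ∈ B}.Finite

/-- The event that no point has its time in `I` and its mark in `C`. -/
def voidEvent {Ω S : Type*} (t : ℕ → Ω → ℝ) (y : ℕ → Ω → S) (I : Set ℝ) (C : Set S) : Set Ω :=
  {ω | ∀ i, t i ω ∈ I → y i ω ∉ C}

/-- The `k`-th time slab of width `h`, counted backwards from time `0`. -/
def slab (h : ℝ) (k : ℕ) : Set ℝ := Ico (-((k + 1) * h)) (-(k * h))

theorem measurableSet_slab (h : ℝ) (k : ℕ) : MeasurableSet (slab h k) := measurableSet_Ico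

theorem volume_slab (h : ℝ) (k : ℕ) : volume (slab h k) = ENNReal.ofReal h := by
  rw [slab, Real.volume_Ico]
  congr 1
  ring

theorem disjoint_slab {h : ℝ} (hh : 0 < h) {k l : ℕ} (hkl : k ≠ l) :
    Disjoint (slab h k) (slab h l) := by
  have key : ∀ k l : ℕ, k < l → Disjoint (slab h k) (slab h l) := by
    intro k l hkl
    refine Set.disjoint_left.2 fun s hs hs' => ?_
    have h1 : ((k : ℝ) + 1) ≤ l := by exact_mod_cast hkl
    have h2 := hs.1
    have h3 := hs'.2
    nlinarith
  rcases lt_or_gt_of_ne hkl with h | h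
  · exact key _ _ h
  · exact (key _ _ h).symm

/-- The backward search for leaves when time is cut into slabs of width `h`. With `j` leaves still to be found from slab `m` on, the first slab that is not
void of `H (j - 1)` is void of `H (j - 1) \ A (j - 1)`, and the search goes on behind it with
`j - 1` leaves. -/
def slabPattern {Ω S : Type*} (t : ℕ → Ω → ℝ) (y : ℕ → Ω → S) (h : ℝ) (H A : ℕ → Set S) :
    ℕ → ℕ → Set Ω
  | 0 => fun _ => univ
  | j + 1 => firstPassage (fun l => voidEvent t y (slab h l) (H j))
      (fun l => voidEvent t y (slab h l) (H j \ A j) \ voidEvent t y (slab h l) (H j))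
      (slabPattern t y h H A j)

namespace HasPoissonVoids

variable {Ω S : Type*} [MeasurableSpace Ω] [MeasurableSpace S]
  {t : ℕ → Ω → ℝ} {y : ℕ → Ω → S} {ρ : Measure S} {P : Measure Ω}

theorem measurableSet_voidEvent (hp : HasPoissonVoids t y ρ P) {I : Set ℝ} (hI : MeasurableSet I)
    {C : Set S} (hC : MeasurableSet C) : MeasurableSet (voidEvent t y I C) := by
  have : voidEvent t y I C = ⋂ i, (t i ⁻¹' I ∩ y i ⁻¹' C)ᶜ := by
    ext ω; simp [voidEvent]
  rw [this]
  exact .iInter fun i => ((hp.measurable_time i hI).inter (hp.measurable_mark i hC)).compl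

theorem measure_biInter_voidEvent [SFinite ρ] (hp : HasPoissonVoids t y ρ P) {ι : Type*}
    (s : Finset ι) {I : ι → Set ℝ} (hI : ∀ l ∈ s, MeasurableSet (I l))
    (hIv : ∀ l ∈ s, volume (I l) ≠ ∞) {C : ι → Set S} (hC : ∀ l ∈ s, MeasurableSet (C l))
    (hCf : ∀ l ∈ s, ρ (C l) ≠ ∞)
    (hd : (s : Set ι).PairwiseDisjoint fun l => I l ×ˢ C l) :
    P (⋂ l ∈ s, voidEvent t y (I l) (C l)) =
      ENNReal.ofReal (Real.exp (-∑ l ∈ s, (volume (I l)).toReal * (ρ (C l)).toReal)) := by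
  have h1 : (⋂ l ∈ s, voidEvent t y (I l) (C l)) =
      {ω | ∀ i, (t i ω, y i ω) ∉ ⋃ l ∈ s, I l ×ˢ C l} := by
    ext ω
    simp only [voidEvent, mem_iInter, mem_ofPred_eq, mem_iUnion, mem_prod, not_exists, not_and]
    exact ⟨fun h i l hl => h l hl i, fun h l hl i => h i l hl⟩
  have h2 : (volume.prod ρ) (⋃ l ∈ s, I l ×ˢ C l) = ∑ l ∈ s, volume (I l) * ρ (C l) := by
    rw [measure_biUnion_finset hd fun l hl => (hI l hl).prod (hC l hl)]
    exact Finset.sum_congr rfl fun l _ => Measure.prod_prod _ _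
  have h3 : ∀ l ∈ s, volume (I l) * ρ (C l) ≠ ∞ := fun l hl =>
    ENNReal.mul_ne_top (hIv l hl) (hCf l hl)
  rw [h1, hp.measure_void _ (Finset.measurableSet_biUnion _ fun l hl => (hI l hl).prod (hC l hl))
    (by rw [h2]; exact ENNReal.sum_ne_top.2 h3), h2, ENNReal.toReal_sum h3]
  simp_rw [ENNReal.toReal_mul]

theorem measure_voidEvent [SFinite ρ] (hp : HasPoissonVoids t y ρ P) {I : Set ℝ}
    (hI : MeasurableSet I) (hIv : volume I ≠ ∞) {C : Set S} (hC : MeasurableSet C)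
    (hCf : ρ C ≠ ∞) :
    P (voidEvent t y I C) =
      ENNReal.ofReal (Real.exp (-((volume I).toReal * (ρ C).toReal))) := by
  have := hp.measure_biInter_voidEvent (Finset.univ : Finset Unit) (I := fun _ => I)
    (C := fun _ => C) (fun _ _ => hI) (fun _ _ => hIv) (fun _ _ => hC) (fun _ _ => hCf)
    (fun a _ b _ h => (h rfl).elim)
  simpa [iInter_const] using this

/-- The void events of one slab; they form a π-system. -/
def slabVoids (t : ℕ → Ω → ℝ) (y : ℕ → Ω → S) (ρ : Measure S) (h : ℝ) (l : ℕ) :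
    Set (Set Ω) :=
  {s | ∃ C, MeasurableSet C ∧ ρ C ≠ ∞ ∧ voidEvent t y (slab h l) C = s}

/-- The information carried by the points of one slab. -/
@[reducible]
def slabSigma (t : ℕ → Ω → ℝ) (y : ℕ → Ω → S) (ρ : Measure S) (h : ℝ) (l : ℕ) :
    MeasurableSpace Ω :=
  MeasurableSpace.generateFrom (slabVoids t y ρ h l)

theorem slabSigma_le (hp : HasPoissonVoids t y ρ P) (h : ℝ) (l : ℕ) :
    slabSigma t y ρ h l ≤ ‹MeasurableSpace Ω› := by
  refine MeasurableSpace.generateFrom_le ?_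
  rintro _ ⟨C, hC, -, rfl⟩
  exact hp.measurableSet_voidEvent (measurableSet_slab h l) hC

/-- Different slabs are independent: by the form of the void probabilities the void events are, and
these generate. -/
theorem iIndep_slabSigma [SFinite ρ] (hp : HasPoissonVoids t y ρ P) {h : ℝ}
    (hh : 0 < h) : iIndep (slabSigma t y ρ h) P := by
  refine iIndepSets.iIndep (hp.slabSigma_le h) (slabVoids t y ρ h) ?_ (fun _ => rfl) ?_
  · rintro l _ ⟨C, hC, hCf, rfl⟩ _ ⟨C', hC', hCf', rfl⟩ -
    refine ⟨C ∪ C', hC.union hC', measure_union_ne_top hCf hCf', ?_⟩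
    ext ω
    simp only [voidEvent, mem_ofPred_eq, mem_union, mem_inter_iff, not_or]
    exact ⟨fun H => ⟨fun i hi => (H i hi).1, fun i hi => (H i hi).2⟩,
      fun H i hi => ⟨H.1 i hi, H.2 i hi⟩⟩
  · rw [iIndepSets_iff]
    intro s f hf
    choose! C hC hCf hCe using hf
    have hv : ∀ l, volume (slab h l) ≠ ∞ := fun l => by
      rw [volume_slab]; exact ENNReal.ofReal_ne_top
    have h1 : (⋂ l ∈ s, f l) = ⋂ l ∈ s, voidEvent t y (slab h l) (C l) :=
      iInter₂_congr fun l hl => (hCe l hl).symm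
    rw [h1, hp.measure_biInter_voidEvent s (fun l _ => measurableSet_slab h l) (fun l _ => hv l) hC
      hCf fun k _ l _ hkl => Set.disjoint_prod.2 (Or.inl (disjoint_slab hh hkl)),
      ← Finset.sum_neg_distrib, Real.exp_sum,
      ENNReal.ofReal_prod_of_nonneg fun _ _ => (Real.exp_pos _).le]
    refine Finset.prod_congr rfl fun l hl => ?_
    rw [← hCe l hl, hp.measure_voidEvent (measurableSet_slab h l) (hv l) (hC l hl) (hCf l hl)]

theorem measurableSet_slabPattern {Ω : Type*} {t : ℕ → Ω → ℝ} {y : ℕ → Ω → S} {h : ℝ}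
    {H A : ℕ → Set S} (hH : ∀ j, MeasurableSet (H j)) (hA : ∀ j, MeasurableSet (A j))
    (hHf : ∀ j, ρ (H j) ≠ ∞) (j m : ℕ) :
    MeasurableSet[⨆ l ∈ Ici m, slabSigma t y ρ h l] (slabPattern t y h H A j m) := by
  induction j generalizing m with
  | zero => exact MeasurableSet.univ
  | succ j ih =>
    refine measurableSet_firstPassage (fun l => ?_) (fun l => ?_) ih m
    · exact MeasurableSpace.measurableSet_generateFrom ⟨_, hH j, hHf j, rfl⟩
    · exact MeasurableSet.diff
        (MeasurableSpace.measurableSet_generateFrom ⟨_, (hH j).diff (hA j),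
          measure_ne_top_of_subset sdiff_subset (hHf j), rfl⟩)
        (MeasurableSpace.measurableSet_generateFrom ⟨_, hH j, hHf j, rfl⟩)

theorem measure_slabPattern [SFinite ρ] [IsProbabilityMeasure P] (hp : HasPoissonVoids t y ρ P)
    {h : ℝ} (hh : 0 < h) {H A : ℕ → Set S} (hH : ∀ j, MeasurableSet (H j))
    (hA : ∀ j, MeasurableSet (A j)) (hAH : ∀ j, A j ⊆ H j) (hHf : ∀ j, ρ (H j) ≠ ∞)
    (hH0 : ∀ j, ρ (H j) ≠ 0) (n m : ℕ) :
    P (slabPattern t y h H A n m) = ENNReal.ofReal (∏ j ∈ Finset.range n,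
      (Real.exp (-(h * ((ρ (H j)).toReal - (ρ (A j)).toReal))) - Real.exp (-(h * (ρ (H j)).toReal)))
        / (1 - Real.exp (-(h * (ρ (H j)).toReal)))) := by
  have hv : ∀ l, (volume (slab h l)).toReal = h := fun l => by
    rw [volume_slab, ENNReal.toReal_ofReal hh.le]
  have hv' : ∀ l, volume (slab h l) ≠ ∞ := fun l => by
    rw [volume_slab]; exact ENNReal.ofReal_ne_top
  have hAf : ∀ j, ρ (A j) ≠ ∞ := fun j => measure_ne_top_of_subset (hAH j) (hHf j)
  have hq1 : ∀ j, Real.exp (-(h * (ρ (H j)).toReal)) < 1 := fun j => by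
    rw [Real.exp_lt_one_iff, neg_lt_zero]
    exact mul_pos hh (ENNReal.toReal_pos (hH0 j) (hHf j))
  have hw0 : ∀ j, 0 ≤ Real.exp (-(h * ((ρ (H j)).toReal - (ρ (A j)).toReal))) -
      Real.exp (-(h * (ρ (H j)).toReal)) := fun j => by
    rw [sub_nonneg, Real.exp_le_exp]
    have : 0 ≤ h * (ρ (A j)).toReal := mul_nonneg hh.le ENNReal.toReal_nonneg
    linarith
  have hfac : ∀ j, 0 ≤ (Real.exp (-(h * ((ρ (H j)).toReal - (ρ (A j)).toReal))) -
      Real.exp (-(h * (ρ (H j)).toReal))) / (1 - Real.exp (-(h * (ρ (H j)).toReal))) := fun j =>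
    div_nonneg (hw0 j) (sub_nonneg.2 (hq1 j).le)
  induction n generalizing m with
  | zero => simp [slabPattern]
  | succ n ih =>
    have hdiff : ρ (H n \ A n) ≠ ∞ := measure_ne_top_of_subset sdiff_subset (hHf n)
    have hsub : ∀ l, voidEvent t y (slab h l) (H n) ⊆ voidEvent t y (slab h l) (H n \ A n) :=
      fun l ω hω i hi hy => hω i hi hy.1
    have hV := fun l => hp.measure_voidEvent (measurableSet_slab h l) (hv' l) (hH n) (hHf n)
    have hD := fun l => hp.measure_voidEvent (measurableSet_slab h l) (hv' l)
      ((hH n).diff (hA n)) hdiff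
    simp_rw [hv] at hV hD
    rw [measure_sdiff (hAH n) (hA n).nullMeasurableSet (hAf n),
      ENNReal.toReal_sub_of_le (measure_mono (hAH n)) (hHf n)] at hD
    have hW : ∀ l, P (voidEvent t y (slab h l) (H n \ A n) \ voidEvent t y (slab h l) (H n)) =
        ENNReal.ofReal (Real.exp (-(h * ((ρ (H n)).toReal - (ρ (A n)).toReal))) -
          Real.exp (-(h * (ρ (H n)).toReal))) := by
      intro l
      rw [measure_sdiff (hsub l)
        (hp.measurableSet_voidEvent (measurableSet_slab h l) (hH n)).nullMeasurableSet
        (measure_ne_top _ _), hV, hD, ENNReal.ofReal_sub _ (Real.exp_pos _).le]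
    rw [slabPattern, measure_firstPassage (hp.slabSigma_le h) (hp.iIndep_slabSigma hh)
      (fun l => MeasurableSpace.measurableSet_generateFrom ⟨_, hH n, hHf n, rfl⟩)
      (fun l => MeasurableSet.diff
        (MeasurableSpace.measurableSet_generateFrom ⟨_, (hH n).diff (hA n), hdiff, rfl⟩)
        (MeasurableSpace.measurableSet_generateFrom ⟨_, hH n, hHf n, rfl⟩))
      (measurableSet_slabPattern hH hA hHf n) (fun l => disjoint_sdiff_right) hV hW ih m,
      Finset.prod_range_succ, mul_comm (∏ j ∈ _, _), ENNReal.ofReal_mul (hfac n)]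
    congr 1
    rw [ENNReal.ofReal_div_of_pos (sub_pos.2 (hq1 n)), ENNReal.div_eq_inv_mul,
      ENNReal.ofReal_sub 1 (Real.exp_pos _).le, ENNReal.ofReal_one]

/-- As the slabs become thin, the pattern probability tends to `∏ⱼ ρ(Aⱼ) / ρ(Hⱼ)`. -/
theorem tendsto_measure_slabPattern [SFinite ρ] [IsProbabilityMeasure P]
    (hp : HasPoissonVoids t y ρ P)
    {h : ℕ → ℝ} (hh : ∀ N, 0 < h N) (hlim : Tendsto h atTop (𝓝 0)) {H A : ℕ → Set S}
    (hH : ∀ j, MeasurableSet (H j))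
    (hA : ∀ j, MeasurableSet (A j)) (hAH : ∀ j, A j ⊆ H j) (hHf : ∀ j, ρ (H j) ≠ ∞)
    (hH0 : ∀ j, ρ (H j) ≠ 0) (n m : ℕ) :
    Tendsto (fun N => P (slabPattern t y (h N) H A n m)) atTop
      (𝓝 ((∏ j ∈ Finset.range n, ρ (A j)) / ∏ j ∈ Finset.range n, ρ (H j))) := by
  simp_rw [fun N => hp.measure_slabPattern (hh N) hH hA hAH hHf hH0 n m]
  have hc : ∀ j, 0 < (ρ (H j)).toReal := fun j => ENNReal.toReal_pos (hH0 j) (hHf j)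
  have hAf : ∀ j, ρ (A j) ≠ ∞ := fun j => measure_ne_top_of_subset (hAH j) (hHf j)
  have hval : (∏ j ∈ Finset.range n, ρ (A j)) / ∏ j ∈ Finset.range n, ρ (H j) =
      ENNReal.ofReal (∏ j ∈ Finset.range n, (ρ (A j)).toReal / (ρ (H j)).toReal) := by
    rw [Finset.prod_div_distrib, ENNReal.ofReal_div_of_pos (Finset.prod_pos fun j _ => hc j),
      ENNReal.ofReal_prod_of_nonneg fun _ _ => ENNReal.toReal_nonneg,
      ENNReal.ofReal_prod_of_nonneg fun _ _ => ENNReal.toReal_nonneg]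
    simp_rw [fun j => ENNReal.ofReal_toReal (hAf j), fun j => ENNReal.ofReal_toReal (hHf j)]
  rw [hval]
  refine ENNReal.tendsto_ofReal (tendsto_finsetProd _ fun j _ => ?_)
  set c := (ρ (H j)).toReal
  set a := (ρ (A j)).toReal
  -- the difference quotients at `0` of `s ↦ exp (-(s b))`
  have hslope : ∀ b : ℝ, Tendsto (fun N => (Real.exp (-(h N * b)) - 1) / h N) atTop (𝓝 (-b)) := by
    intro b
    have hd : HasDerivAt (fun s : ℝ => Real.exp (-(s * b))) (-b) 0 := by
      have := ((hasDerivAt_id (0 : ℝ)).mul_const b).neg.exp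
      simpa using this
    have h2 := hasDerivAt_iff_tendsto_slope.1 hd
    have h3 : Tendsto h atTop (𝓝[≠] 0) :=
      tendsto_nhdsWithin_iff.2 ⟨hlim, Eventually.of_forall fun N => (hh N).ne'⟩
    refine (h2.comp h3).congr fun N => ?_
    simp [slope_def_field]
  have h4 := ((hslope (c - a)).sub (hslope c)).div (hslope c).neg (by simpa using (hc j).ne')
  have h5 : (-(c - a) - -c) / - -c = a / c := by ring_nf
  rw [h5] at h4
  refine h4.congr fun N => ?_
  have := (hh N).ne'
  simp only [Pi.div_apply]
  rw [← sub_div, ← neg_div, div_div_div_cancel_right₀ this]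
  congr 1 <;> ring

end HasPoissonVoids

/-! ### Chains of points searched backwards in time -/

/-- Searching backwards from time `s`, the next point with mark in `H (j - 1)` has its mark in
`A (j - 1)`, and behind it the search succeeds with `j - 1`. -/
def backwardChain {S : Type*} (t : ℕ → ℝ) (y : ℕ → S) (H A : ℕ → Set S) : ℕ → ℝ → Prop
  | 0, _ => True
  | j + 1, s => ∃ i, t i < s ∧ y i ∈ A j ∧ (∀ l, t i < t l → t l < s → y l ∉ H j) ∧
      backwardChain t y H A j (t i)

theorem exists_mem_slab {h u : ℝ} (hh : 0 < h) (hu : u < 0) : ∃ k, u ∈ slab h k := by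
  have hpos : 0 < -u / h := div_pos (neg_pos.2 hu) hh
  have h1 : 0 < ⌈-u / h⌉₊ := Nat.ceil_pos.2 hpos
  obtain ⟨k, hk⟩ : ∃ k, ⌈-u / h⌉₊ = k + 1 := ⟨_, (Nat.succ_pred_eq_of_pos h1).symm⟩
  have h2 : -u / h ≤ k + 1 := by
    have := Nat.le_ceil (-u / h)
    rw [hk] at this
    exact_mod_cast this
  have h3 : (k : ℝ) < -u / h := Nat.lt_ceil.1 (by omega)
  rw [div_le_iff₀ hh] at h2
  rw [lt_div_iff₀ hh] at h3
  exact ⟨k, by linarith, by linarith⟩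

theorem lt_of_mem_slab {h u : ℝ} (hh : 0 < h) {k m : ℕ} (hu : u ∈ slab h k)
    (hm : -(m * h) ≤ u) : k < m := by
  have h1 : (k : ℝ) * h < m * h := by linarith [hu.2]
  exact_mod_cast lt_of_mul_lt_mul_right h1 hh.le

theorem le_of_mem_slab {h u : ℝ} (hh : 0 < h) {k m : ℕ} (hu : u ∈ slab h k)
    (hm : u < -(m * h)) : m ≤ k := by
  have h1 : (m : ℝ) * h < (k + 1) * h := by linarith [hu.1]
  have h2 : (m : ℝ) < k + 1 := lt_of_mul_lt_mul_right h1 hh.le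
  exact Nat.lt_succ_iff.1 (by exact_mod_cast h2)

section Chains

variable {Ω S : Type*} {t : ℕ → Ω → ℝ} {y : ℕ → Ω → S} {H A : ℕ → Set S} {ω : Ω}

/-- The slack between `-(m * h)` and `s`, free of marks in `H i` for `i < j`, lets the induction pass
from the end of a slab to the exact time of the point found in it. -/
theorem backwardChain_of_mem_slabPattern (hmono : Monotone H) (hAH : ∀ j, A j ⊆ H j)
    (hdis : ∀ i j, i < j → Disjoint (A j) (H i))
    (hfin : ∀ j (T : ℕ), {i | t i ω ∈ Ico (-(T : ℝ)) 0 ∧ y i ω ∈ H j}.Finite)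
    {h : ℝ} (hh : 0 < h) {j m : ℕ} (hω : ω ∈ slabPattern t y h H A j m) {s : ℝ}
    (hs : -(m * h) ≤ s)
    (hvoid : ∀ i < j, ∀ l, t l ω ∈ Ico (-(m * h)) s → y l ω ∉ H i) :
    backwardChain (fun i => t i ω) (fun i => y i ω) H A j s := by
  induction j generalizing m s with
  | zero => trivial
  | succ j ih =>
    obtain ⟨k, hV, hW, hR⟩ := hω
    have hA : ∀ l, t l ω ∈ slab h (m + k) → y l ω ∈ H j → y l ω ∈ A j := fun l hl hl' => by
      by_contra hc
      exact hW.1 l hl ⟨hl', hc⟩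
    have hslab0 : ∀ u, u ∈ slab h (m + k) → u < -(m * h) := fun u hu => by
      have := hu.2
      push_cast at this
      nlinarith [mul_nonneg (Nat.cast_nonneg (α := ℝ) k) hh.le]
    have hm0 : 0 ≤ (m : ℝ) * h := by positivity
    -- the latest of the points that make the slab `m + k` non-void
    obtain ⟨i, ⟨hi, hiA⟩, himax⟩ : ∃ i ∈ {l | t l ω ∈ slab h (m + k) ∧ y l ω ∈ A j},
        ∀ l ∈ {l | t l ω ∈ slab h (m + k) ∧ y l ω ∈ A j}, t l ω ≤ t i ω := by
      refine Set.exists_max_image _ (fun l => t l ω) ?_ ?_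
      · obtain ⟨T, hT⟩ := exists_nat_ge (((m + k : ℕ) + 1) * h)
        refine (hfin j T).subset fun l hl => ⟨⟨?_, ?_⟩, hAH j hl.2⟩
        · linarith [hl.1.1]
        · linarith [hslab0 _ hl.1]
      · have := hW.2
        simp only [voidEvent, mem_ofPred_eq, not_forall, not_not] at this
        obtain ⟨l, hl, hlH⟩ := this
        exact ⟨l, hl, hA l hl hlH⟩
    refine ⟨i, (hslab0 _ hi).trans_le hs, hiA, fun l hil hls hlH => ?_, ?_⟩
    · rcases le_or_gt (-(m * h)) (t l ω) with h1 | h1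
      · exact hvoid j (Nat.lt_succ_self j) l ⟨h1, hls⟩ hlH
      rcases le_or_gt (-((m + k : ℕ) * h)) (t l ω) with h2 | h2
      · obtain ⟨k', hk'⟩ := exists_mem_slab hh (h1.trans_le (neg_nonpos.2 hm0))
        obtain ⟨d, rfl⟩ := Nat.exists_eq_add_of_le (le_of_mem_slab hh hk' h1)
        have := lt_of_mem_slab hh hk' h2
        exact hV d (by omega) l hk' hlH
      · have hl : t l ω ∈ slab h (m + k) := ⟨hi.1.trans hil.le, h2⟩
        exact absurd (himax l ⟨hl, hA l hl hlH⟩) (not_le.2 hil)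
    · refine ih hR (by have := hi.1; push_cast at this ⊢; linarith) fun i' hi' l hl hlH => ?_
      have hl' : t l ω ∈ slab h (m + k) :=
        ⟨by have := hl.1; push_cast at this ⊢; linarith, hl.2.trans hi.2⟩
      exact Set.disjoint_left.1 (hdis i' j hi') (hA l hl' (hmono hi'.le hlH)) hlH

/-- For thin slabs the points of the chain lie in different slabs, and by local finiteness and the
absence of ties the slab of each holds no other points of its `H j` outside `A j`. The search may
start from any slab boundary in `(s - h, s]`. -/
theorem eventually_mem_slabPattern_of_backwardChain
    (hfin : ∀ j (T : ℕ), {i | t i ω ∈ Ico (-(T : ℝ)) 0 ∧ y i ω ∈ H j}.Finite)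
    (hAH : ∀ j, A j ⊆ H j)
    (htie : ∀ j i l, t i ω < 0 → y i ω ∈ A j → y l ω ∈ H j \ A j → t i ω ≠ t l ω)
    {j : ℕ} {s : ℝ} (hs : s ≤ 0)
    (hω : backwardChain (fun i => t i ω) (fun i => y i ω) H A j s) :
    ∀ᶠ h in 𝓝[>] (0 : ℝ), ∀ m : ℕ, -(m * h) ≤ s → s - h < -(m * h) →
      ω ∈ slabPattern t y h H A j m := by
  induction j generalizing s with
  | zero => exact Eventually.of_forall fun _ _ _ _ => trivial
  | succ j ih =>
    obtain ⟨i, his, hiA, hgap, hchain⟩ := hω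
    have hi0 : t i ω < 0 := his.trans_le hs
    obtain ⟨T, hT⟩ := exists_nat_ge (1 - t i ω)
    have hsmall : ∀ c > (0 : ℝ), ∀ᶠ h in 𝓝[>] (0 : ℝ), h < c := fun c hc =>
      (eventually_lt_nhds hc).filter_mono nhdsWithin_le_nhds
    -- by finiteness, no point of `H j` comes shortly before `t i`
    have hbefore : ∀ᶠ h in 𝓝[>] (0 : ℝ),
        ∀ l ∈ {l | t l ω ∈ Ico (-(T : ℝ)) 0 ∧ y l ω ∈ H j}, t l ω < t i ω → t l ω < t i ω - h := by
      refine (eventually_all_finite (hfin j T)).2 fun l _ => ?_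
      by_cases hl : t l ω < t i ω
      · filter_upwards [hsmall _ (sub_pos.2 hl)] with h hh _
        linarith
      · exact Eventually.of_forall fun _ h => absurd h hl
    filter_upwards [ih hi0.le hchain, hbefore, hsmall _ (sub_pos.2 his), hsmall 1 one_pos,
      self_mem_nhdsWithin] with h hIH hb hlt h1 hpos m hm1 hm2
    have hh : 0 < h := hpos
    obtain ⟨k', hk'⟩ := exists_mem_slab hh hi0
    obtain ⟨k, rfl⟩ := Nat.exists_eq_add_of_le
      (le_of_mem_slab hh hk' (show t i ω < -(m * h) by linarith))
    refine ⟨k, fun d hd l hl => ?_, ⟨fun l hl hlH => ?_, fun hv => ?_⟩, ?_⟩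
    · refine hgap l ?_ ?_
      · have h2 : ((m + d : ℕ) + 1 : ℝ) * h ≤ (m + k : ℕ) * h :=
          mul_le_mul_of_nonneg_right (by exact_mod_cast (by omega)) hh.le
        change t i ω < t l ω
        linarith [hl.1, hk'.2]
      · have h2 : (m : ℝ) * h ≤ (m + d : ℕ) * h :=
          mul_le_mul_of_nonneg_right (by exact_mod_cast (by omega)) hh.le
        change t l ω < s
        linarith [hl.2]
    · have h2 : (m : ℝ) * h ≤ (m + k : ℕ) * h :=
        mul_le_mul_of_nonneg_right (by exact_mod_cast (by omega)) hh.le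
      have hls : t l ω < s := by linarith [hl.2]
      rcases lt_trichotomy (t i ω) (t l ω) with h3 | h3 | h3
      · exact hgap l h3 hls hlH.1
      · exact htie j i l hi0 hiA hlH h3
      · have := hb l ⟨⟨by linarith [hl.1, hk'.2], by linarith⟩, hlH.1⟩ h3
        linarith [hl.1, hk'.2]
    · exact hv i hk' (hAH j hiA)
    · refine hIH _ ?_ ?_
      · have := hk'.1; push_cast at this ⊢; linarith
      · have := hk'.2; push_cast at this ⊢; linarith

end Chains

namespace HasPoissonVoids

variable {Ω S : Type*} [MeasurableSpace Ω] [MeasurableSpace S]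
  {t : ℕ → Ω → ℝ} {y : ℕ → Ω → S} {ρ : Measure S} {P : Measure Ω}

theorem ae_time_ne [SFinite ρ] [IsProbabilityMeasure P] (hp : HasPoissonVoids t y ρ P) (s : ℝ) :
    ∀ᵐ ω ∂P, ∀ i, t i ω ≠ s := by
  have h0 : (volume.prod ρ) ({s} ×ˢ (univ : Set S)) = 0 := by
    rw [Measure.prod_prod, Real.volume_singleton, zero_mul]
  have h1 := hp.measure_void _ ((measurableSet_singleton s).prod MeasurableSet.univ)
    (by rw [h0]; exact ENNReal.zero_ne_top)
  rw [h0, ENNReal.toReal_zero, neg_zero, Real.exp_zero, ENNReal.ofReal_one] at h1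
  have hm : MeasurableSet {ω | ∀ i, (t i ω, y i ω) ∉ ({s} ×ˢ (univ : Set S))} := by
    have := hp.measurableSet_voidEvent (measurableSet_singleton s) (C := univ) MeasurableSet.univ
    convert this using 1
    ext ω
    simp [voidEvent]
  have h2 := (prob_compl_eq_zero_iff hm).2 h1
  rw [← mem_ae_iff] at h2
  filter_upwards [h2] with ω hω i hi
  exact hω i ⟨hi, trivial⟩

/-- Points with marks in two disjoint sets never share their time: among the slabs of width `h`
covering a bounded time interval, the expected number that contain points of both kinds is `O(h)`. -/
theorem ae_time_ne_of_disjoint [SFinite ρ] [IsProbabilityMeasure P] (hp : HasPoissonVoids t y ρ P)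
    {C D : Set S} (hC : MeasurableSet C) (hD : MeasurableSet D) (hCf : ρ C ≠ ∞) (hDf : ρ D ≠ ∞)
    (hCD : Disjoint C D) :
    ∀ᵐ ω ∂P, ∀ i l, t i ω < 0 → y i ω ∈ C → y l ω ∈ D → t i ω ≠ t l ω := by
  suffices hT : ∀ T : ℕ, ∀ᵐ ω ∂P, ∀ i l, t i ω ∈ Ico (-(T : ℝ)) 0 → y i ω ∈ C → y l ω ∈ D →
      t i ω ≠ t l ω by
    filter_upwards [ae_all_iff.2 hT] with ω hω i l hi
    obtain ⟨T, hT⟩ := exists_nat_ge (-t i ω)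
    exact hω T i l ⟨by linarith, hi⟩
  intro T
  set a := (ρ C).toReal
  set b := (ρ D).toReal
  have hslab : ∀ (h : ℝ), 0 < h → ∀ k, P ((voidEvent t y (slab h k) C)ᶜ ∩
      (voidEvent t y (slab h k) D)ᶜ) ≤ ENNReal.ofReal (h * a * (h * b)) := by
    intro h hh k
    have hv : volume (slab h k) ≠ ∞ := by rw [volume_slab]; exact ENNReal.ofReal_ne_top
    have hv' : (volume (slab h k)).toReal = h := by rw [volume_slab, ENNReal.toReal_ofReal hh.le]
    have hms := measurableSet_slab h k
    have hmC := hp.measurableSet_voidEvent hms hC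
    have hmD := hp.measurableSet_voidEvent hms hD
    have hPC := hp.measure_voidEvent hms hv hC hCf
    have hPD := hp.measure_voidEvent hms hv hD hDf
    have hPCD := hp.measure_voidEvent hms hv (hC.union hD) (measure_union_ne_top hCf hDf)
    rw [hv'] at hPC hPD hPCD
    have hinter : voidEvent t y (slab h k) (C ∪ D) =
        voidEvent t y (slab h k) C ∩ voidEvent t y (slab h k) D := by
      ext ω
      simp only [voidEvent, mem_ofPred_eq, mem_union, mem_inter_iff, not_or]
      exact ⟨fun H => ⟨fun i hi => (H i hi).1, fun i hi => (H i hi).2⟩,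
        fun H i hi => ⟨H.1 i hi, H.2 i hi⟩⟩
    rw [hinter, measure_union hCD hD, ENNReal.toReal_add hCf hDf] at hPCD
    have hreal : ∀ c : ℝ, (ENNReal.ofReal (Real.exp (-(h * c)))).toReal = Real.exp (-(h * c)) :=
      fun c => ENNReal.toReal_ofReal (Real.exp_pos _).le
    have hval : P.real ((voidEvent t y (slab h k) C)ᶜ ∩ (voidEvent t y (slab h k) D)ᶜ) =
        (1 - Real.exp (-(h * a))) * (1 - Real.exp (-(h * b))) := by
      rw [← compl_union, probReal_compl_eq_one_sub (hmC.union hmD)]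
      have hu := measureReal_union_add_inter (μ := P) (s := voidEvent t y (slab h k) C) hmD
      rw [measureReal_def (s := _ ∩ _), hPCD, measureReal_def (s := voidEvent t y (slab h k) C),
        hPC, measureReal_def (s := voidEvent t y (slab h k) D), hPD, hreal, hreal, hreal,
        show -(h * (a + b)) = -(h * a) + -(h * b) by ring, Real.exp_add] at hu
      linarith
    rw [← ofReal_measureReal, hval]
    refine ENNReal.ofReal_le_ofReal (mul_le_mul ?_ ?_ ?_ ?_)
    · linarith [Real.add_one_le_exp (-(h * a))]
    · linarith [Real.add_one_le_exp (-(h * b))]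
    · rw [sub_nonneg, Real.exp_le_one_iff, neg_nonpos]
      exact mul_nonneg hh.le ENNReal.toReal_nonneg
    · exact mul_nonneg hh.le ENNReal.toReal_nonneg
  rw [ae_iff]
  set Z := {ω | ¬ ∀ i l, t i ω ∈ Ico (-(T : ℝ)) 0 → y i ω ∈ C → y l ω ∈ D → t i ω ≠ t l ω} with hZ
  have hbound : ∀ N : ℕ, P Z ≤ ENNReal.ofReal (T * a * b / (N + 1 : ℝ)) := by
    intro N
    have hN : (0 : ℝ) < N + 1 := by positivity
    set h : ℝ := 1 / (N + 1) with hh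
    have hpos : 0 < h := by positivity
    have hsub : Z ⊆ ⋃ k ∈ Finset.range (T * (N + 1)), (voidEvent t y (slab h k) C)ᶜ ∩
        (voidEvent t y (slab h k) D)ᶜ := by
      intro ω hω
      simp only [hZ, mem_ofPred_eq, not_forall, not_not] at hω
      obtain ⟨i, l, hi, hiC, hlD, hil⟩ := hω
      obtain ⟨k, hk⟩ := exists_mem_slab hpos hi.2
      refine mem_iUnion₂.2 ⟨k, ?_, fun hv => hv i hk hiC, fun hv => hv l (hil ▸ hk) hlD⟩
      refine Finset.mem_range.2 (lt_of_mem_slab hpos hk ?_)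
      have : ((T * (N + 1) : ℕ) : ℝ) * h = T := by
        rw [hh]; push_cast; field_simp
      rw [this]
      exact hi.1
    refine (measure_mono hsub).trans ((measure_biUnion_finset_le _ _).trans ?_)
    refine (Finset.sum_le_sum fun k _ => hslab h hpos k).trans (le_of_eq ?_)
    rw [Finset.sum_const, Finset.card_range, nsmul_eq_mul, ← ENNReal.ofReal_natCast,
      ← ENNReal.ofReal_mul (by positivity)]
    congr 1
    rw [hh]; push_cast; field_simp
  have hlim : Tendsto (fun N : ℕ => ENNReal.ofReal (T * a * b / (N + 1 : ℝ))) atTop (𝓝 0) := by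
    have h1 := (tendsto_one_div_add_atTop_nhds_zero_nat (𝕜 := ℝ)).const_mul (T * a * b)
    rw [mul_zero] at h1
    have h2 := ENNReal.tendsto_ofReal h1
    rw [ENNReal.ofReal_zero] at h2
    refine h2.congr fun N => ?_
    rw [mul_one_div]
  exact le_antisymm (ge_of_tendsto' hlim hbound) zero_le

/-- The probability of a chain of `n` points from time `0` is `∏ⱼ ρ(Aⱼ) / ρ(Hⱼ)`: almost surely,
the chain exists if and only if the slab pattern occurs for all thin slabs. -/
theorem measure_backwardChain [SFinite ρ] [IsProbabilityMeasure P] (hp : HasPoissonVoids t y ρ P)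
    {H A : ℕ → Set S} (hH : ∀ j, MeasurableSet (H j)) (hA : ∀ j, MeasurableSet (A j))
    (hmono : Monotone H) (hAH : ∀ j, A j ⊆ H j) (hdis : ∀ i j, i < j → Disjoint (A j) (H i))
    (hHf : ∀ j, ρ (H j) ≠ ∞) (hH0 : ∀ j, ρ (H j) ≠ 0) (n : ℕ) :
    NullMeasurableSet {ω | backwardChain (fun i => t i ω) (fun i => y i ω) H A n 0} P ∧
    P {ω | backwardChain (fun i => t i ω) (fun i => y i ω) H A n 0} =
      (∏ j ∈ Finset.range n, ρ (A j)) / ∏ j ∈ Finset.range n, ρ (H j) := by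
  have hfin : ∀ᵐ ω ∂P, ∀ j (T : ℕ), {i | t i ω ∈ Ico (-(T : ℝ)) 0 ∧ y i ω ∈ H j}.Finite := by
    refine ae_all_iff.2 fun j => ae_all_iff.2 fun T => ?_
    refine hp.ae_finite (Ico (-(T : ℝ)) 0 ×ˢ H j) (measurableSet_Ico.prod (hH j)) ?_
    rw [Measure.prod_prod]
    exact ENNReal.mul_ne_top (by simp) (hHf j)
  have htie : ∀ᵐ ω ∂P, ∀ j i l, t i ω < 0 → y i ω ∈ A j → y l ω ∈ H j \ A j → t i ω ≠ t l ω :=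
    ae_all_iff.2 fun j => hp.ae_time_ne_of_disjoint (hA j) ((hH j).diff (hA j))
      (measure_ne_top_of_subset (hAH j) (hHf j)) (measure_ne_top_of_subset sdiff_subset (hHf j))
      disjoint_sdiff_right
  set h : ℕ → ℝ := fun N => 1 / (N + 1) with hh
  have hpos : ∀ N, 0 < h N := fun N => by positivity
  have hlim : Tendsto h atTop (𝓝 0) := tendsto_one_div_add_atTop_nhds_zero_nat
  have hlim' : Tendsto h atTop (𝓝[>] 0) :=
    tendsto_nhdsWithin_iff.2 ⟨hlim, Eventually.of_forall hpos⟩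
  have hm : ∀ N, MeasurableSet (slabPattern t y (h N) H A n 0) := fun N =>
    iSup₂_le (fun l _ => hp.slabSigma_le (h N) l) _ (measurableSet_slabPattern hH hA hHf n 0)
  have hsub : ∀ᵐ ω ∂P, ∀ N, ω ∈ slabPattern t y (h N) H A n 0 →
      backwardChain (fun i => t i ω) (fun i => y i ω) H A n 0 := by
    filter_upwards [hfin] with ω hω N hN
    exact backwardChain_of_mem_slabPattern hmono hAH hdis hω (hpos N) hN (by simp) (by simp)
  have hev : ∀ᵐ ω ∂P, backwardChain (fun i => t i ω) (fun i => y i ω) H A n 0 →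
      ∀ᶠ N in atTop, ω ∈ slabPattern t y (h N) H A n 0 := by
    filter_upwards [hfin, htie] with ω hω hω' hc
    filter_upwards [hlim'.eventually
      (eventually_mem_slabPattern_of_backwardChain hω hAH hω' le_rfl hc)] with N hN
    exact hN 0 (by simp) (by simpa using hpos N)
  have hae : (⋃ N, slabPattern t y (h N) H A n 0) =ᵐ[P]
      {ω | backwardChain (fun i => t i ω) (fun i => y i ω) H A n 0} := by
    filter_upwards [hsub, hev] with ω h1 h2
    refine propext ⟨fun h3 => ?_, fun h3 => ?_⟩
    · obtain ⟨N, hN⟩ := mem_iUnion.1 h3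
      exact h1 N hN
    · obtain ⟨N, hN⟩ := (h2 h3).exists
      exact mem_iUnion.2 ⟨N, hN⟩
  refine ⟨(MeasurableSet.iUnion hm).nullMeasurableSet.congr hae, ?_⟩
  rw [← measure_congr hae]
  refine tendsto_nhds_unique ?_ (hp.tendsto_measure_slabPattern hpos hlim hH hA hAH hHf hH0 n 0)
  refine tendsto_measure_of_ae_tendsto_indicator_of_isFiniteMeasure _ (MeasurableSet.iUnion hm) hm ?_
  filter_upwards [hsub, hev] with ω h1 h2
  by_cases hc : backwardChain (fun i => t i ω) (fun i => y i ω) H A n 0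
  · filter_upwards [h2 hc] with N hN
    exact ⟨fun _ => mem_iUnion.2 ⟨N, hN⟩, fun _ => hN⟩
  · refine Eventually.of_forall fun N => ⟨fun h3 => (hc (h1 N h3)).elim, fun h3 => ?_⟩
    obtain ⟨N', hN'⟩ := mem_iUnion.1 h3
    exact (hc (h1 N' hN')).elim

end HasPoissonVoids

/-! ### Measurability for random closed sets -/

theorem measurableSet_inter_eq_empty {K : Set Plane} (hK : IsCompact K) :
    MeasurableSet {F : Closeds Plane | (F : Set Plane) ∩ K = ∅} :=
  MeasurableSpace.measurableSet_generateFrom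
    (TopologicalSpace.isOpen_generateFrom_of_mem (Or.inl ⟨K, hK, rfl⟩))

theorem measurableSet_inter_nonempty {G : Set Plane} (hG : IsOpen G) :
    MeasurableSet {F : Closeds Plane | ((F : Set Plane) ∩ G).Nonempty} :=
  MeasurableSpace.measurableSet_generateFrom
    (TopologicalSpace.isOpen_generateFrom_of_mem (Or.inr ⟨G, hG, rfl⟩))

/-- A closed set contains `C` as soon as it contains a countable dense part of `C`. -/
theorem measurableSet_subset (C : Set Plane) :
    MeasurableSet {F : Closeds Plane | C ⊆ F} := by
  obtain ⟨D, hDC, hDc, hCD⟩ :=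
    (TopologicalSpace.IsSeparable.of_separableSpace C).exists_countable_dense_subset
  have h : {F : Closeds Plane | C ⊆ F} = ⋂ d ∈ D, {F : Closeds Plane | (F : Set Plane) ∩ {d} = ∅}ᶜ := by
    ext F
    simp only [mem_ofPred_eq, mem_iInter, mem_compl_iff, inter_singleton_eq_empty, not_not]
    exact ⟨fun h d hd => h (hDC hd), fun h => hCD.trans (closure_minimal h F.isClosed)⟩
  rw [h]
  exact .biInter hDc fun d _ => (measurableSet_inter_eq_empty isCompact_singleton).compl

theorem measurableSet_eq_closure_interior :
    MeasurableSet {F : Closeds Plane | (F : Set Plane) = closure (interior (F : Set Plane))} := by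
  set u := denseSeq Plane
  have hu : DenseRange u := denseRange_denseSeq Plane
  -- It suffices that each small ball meeting `F` contains a small ball inside `F`.
  have h : {F : Closeds Plane | (F : Set Plane) = closure (interior (F : Set Plane))} =
      ⋂ (a : ℕ) (N : ℕ), ({F : Closeds Plane |
        ((F : Set Plane) ∩ Metric.ball (u a) (1 / (N + 1))).Nonempty}ᶜ ∪
        ⋃ (b : ℕ) (M : ℕ) (_ : u b ∈ Metric.ball (u a) (1 / (N + 1))),
          {F : Closeds Plane | Metric.ball (u b) (1 / (M + 1)) ⊆ F}) := by
    ext F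
    simp only [mem_ofPred_eq, mem_iInter, mem_union, mem_compl_iff, mem_iUnion, exists_prop]
    constructor
    · intro hF a N
      rw [or_iff_not_imp_left, not_not]
      rintro ⟨p, hp, hpa⟩
      rw [hF] at hp
      obtain ⟨p', hp'a, hp'⟩ := mem_closure_iff.1 hp _ Metric.isOpen_ball hpa
      have hopen : IsOpen (Metric.ball (u a) (1 / (N + 1 : ℝ)) ∩ interior (F : Set Plane)) :=
        Metric.isOpen_ball.inter isOpen_interior
      obtain ⟨b, hb⟩ := hu.exists_mem_open hopen ⟨p', hp'a, hp'⟩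
      obtain ⟨ε, hε, hball⟩ := Metric.isOpen_iff.1 isOpen_interior _ hb.2
      obtain ⟨M, hM⟩ := exists_nat_one_div_lt hε
      exact ⟨b, M, hb.1, (Metric.ball_subset_ball hM.le).trans (hball.trans interior_subset)⟩
    · intro hF
      refine Subset.antisymm (fun p hp => ?_) (closure_minimal interior_subset F.isClosed)
      rw [Metric.mem_closure_iff]
      intro ε hε
      obtain ⟨N, hN⟩ := exists_nat_one_div_lt (half_pos hε)
      obtain ⟨a, ha⟩ := hu.exists_dist_lt p (Nat.one_div_pos_of_nat (α := ℝ) (n := N))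
      rcases hF a N with h1 | ⟨b, M, hb, hbF⟩
      · exact (h1 ⟨p, hp, ha⟩).elim
      · refine ⟨u b, interior_maximal hbF Metric.isOpen_ball
          (Metric.mem_ball_self Nat.one_div_pos_of_nat), ?_⟩
        rw [Metric.mem_ball, dist_comm] at hb
        linarith [dist_triangle p (u a) (u b)]
  rw [h]
  refine .iInter fun a => .iInter fun N => .union ?_ ?_
  · exact (measurableSet_inter_nonempty Metric.isOpen_ball).compl
  · exact .iUnion fun b => .iUnion fun M => .iUnion fun _ => measurableSet_subset _

/-- The pairs `(x, F)` for which the translated set `x + F` meets `K`. -/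
def hitSet (K : Set Plane) : Set (Plane × Closeds Plane) :=
  {p | ((p.1 +ᵥ (p.2 : Set Plane)) ∩ K).Nonempty}

/-- The pairs `(x, F)` for which `K` lies in the interior of the translated set `x + F`. -/
def coverSet (K : Set Plane) : Set (Plane × Closeds Plane) :=
  {p | K ⊆ p.1 +ᵥ interior (p.2 : Set Plane)}

theorem hitSet_biUnion {ι : Type*} (s : Set ι) (K : ι → Set Plane) :
    hitSet (⋃ i ∈ s, K i) = ⋃ i ∈ s, hitSet (K i) := by
  ext p
  simp only [hitSet, mem_ofPred_eq, inter_iUnion, nonempty_iUnion, mem_iUnion]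

theorem coverSet_subset_hitSet {K : Set Plane} (hK : K.Nonempty) : coverSet K ⊆ hitSet K := by
  rintro p hp
  obtain ⟨k, hk⟩ := hK
  exact ⟨k, vadd_set_mono interior_subset (hp hk), hk⟩

/-- The position `x` is replaced by a point `q` of a countable dense set at distance less than `ε`,
at the price of thickening `K` by `ε`. -/
theorem measurableSet_hitSet {K : Set Plane} (hK : IsCompact K) : MeasurableSet (hitSet K) := by
  set u := denseSeq Plane
  have hu : DenseRange u := denseRange_denseSeq Plane
  have h : (hitSet K)ᶜ = ⋃ (N : ℕ) (a : ℕ), Metric.ball (u a) (1 / (N + 1)) ×ˢ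
      {F : Closeds Plane | (F : Set Plane) ∩
        (-u a +ᵥ Metric.cthickening (1 / (N + 1)) K) = ∅} := by
    ext ⟨x, F⟩
    simp only [hitSet, mem_compl_iff, mem_ofPred_eq, not_nonempty_iff_eq_empty, mem_iUnion,
      mem_prod]
    constructor
    · intro hxF
      obtain ⟨δ, hδ, hdisj⟩ := (Set.disjoint_iff_inter_eq_empty.2 hxF).symm.exists_cthickenings hK
        (F.isClosed.vadd x)
      obtain ⟨N, hN⟩ := exists_nat_one_div_lt hδ
      obtain ⟨a, ha⟩ := hu.exists_dist_lt x (Nat.one_div_pos_of_nat (α := ℝ) (n := N))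
      refine ⟨N, a, ha, ?_⟩
      rw [eq_empty_iff_forall_notMem]
      rintro f ⟨hf, hfK⟩
      rw [mem_vadd_set_iff_neg_vadd_mem, neg_neg, vadd_eq_add] at hfK
      refine Set.disjoint_left.1 hdisj (Metric.cthickening_mono hN.le K hfK) ?_
      refine Metric.mem_cthickening_of_dist_le _ (x + f) δ _ (vadd_mem_vadd_set hf) ?_
      rw [dist_add_right, dist_comm]
      exact ha.le.trans hN.le
    · rintro ⟨N, a, ha, hF⟩
      rw [eq_empty_iff_forall_notMem] at hF ⊢
      rintro p ⟨hp, hpK⟩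
      rw [mem_vadd_set] at hp
      obtain ⟨f, hf, rfl⟩ := hp
      refine hF f ⟨hf, ?_⟩
      rw [mem_vadd_set_iff_neg_vadd_mem, neg_neg, vadd_eq_add]
      refine Metric.mem_cthickening_of_dist_le _ (x + f) _ _ hpK ?_
      rw [dist_add_right, dist_comm]
      exact (Metric.mem_ball.1 ha).le
  refine MeasurableSet.of_compl ?_
  rw [h]
  refine .iUnion fun N => .iUnion fun a => measurableSet_ball.prod ?_
  exact measurableSet_inter_eq_empty (hK.cthickening.vadd _)

theorem measurableSet_coverSet {K : Set Plane} (hK : IsCompact K) :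
    MeasurableSet (coverSet K) := by
  set u := denseSeq Plane
  have hu : DenseRange u := denseRange_denseSeq Plane
  have h : coverSet K = ⋃ (N : ℕ) (a : ℕ), Metric.ball (u a) (1 / (N + 1)) ×ˢ
      {F : Closeds Plane | (-u a +ᵥ Metric.cthickening (1 / (N + 1)) K) ⊆ F} := by
    ext ⟨x, F⟩
    simp only [coverSet, mem_ofPred_eq, mem_iUnion, mem_prod]
    constructor
    · intro hxF
      obtain ⟨δ, hδ, hsub⟩ := hK.exists_cthickening_subset_open (isOpen_interior.vadd x) hxF
      obtain ⟨N, hN⟩ := exists_nat_one_div_lt (half_pos hδ)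
      obtain ⟨a, ha⟩ := hu.exists_dist_lt x (Nat.one_div_pos_of_nat (α := ℝ) (n := N))
      refine ⟨N, a, ha, ?_⟩
      intro f hf
      rw [mem_vadd_set_iff_neg_vadd_mem, neg_neg, vadd_eq_add,
        hK.cthickening_eq_biUnion_closedBall Nat.one_div_pos_of_nat.le] at hf
      obtain ⟨k, hk, hfk⟩ := mem_iUnion₂.1 hf
      have hd : x + f ∈ Metric.cthickening δ K := by
        refine Metric.mem_cthickening_of_dist_le _ k _ _ hk ?_
        have h1 : dist (x + f) (u a + f) = dist x (u a) := dist_add_right _ _ _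
        linarith [dist_triangle (x + f) (u a + f) k, Metric.mem_closedBall.1 hfk]
      have := hsub hd
      rw [mem_vadd_set_iff_neg_vadd_mem, vadd_eq_add, neg_add_cancel_left] at this
      exact interior_subset this
    · rintro ⟨N, a, ha, hF⟩ k hk
      rw [mem_vadd_set_iff_neg_vadd_mem, vadd_eq_add]
      have hball : Metric.ball (-u a + k) (1 / (N + 1)) ⊆ (F : Set Plane) := by
        refine Subset.trans (fun f hf => ?_) hF
        rw [mem_vadd_set_iff_neg_vadd_mem, neg_neg, vadd_eq_add]
        refine Metric.mem_cthickening_of_dist_le _ k _ _ hk ?_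
        have h1 : dist (u a + f) (u a + (-u a + k)) = dist f (-u a + k) := dist_add_left _ _ _
        rw [add_neg_cancel_left] at h1
        rw [h1]
        exact (Metric.mem_ball.1 hf).le
      refine interior_maximal hball Metric.isOpen_ball ?_
      rw [Metric.mem_ball, dist_add_right, dist_neg_neg]
      exact ha
  rw [h]
  exact .iUnion fun N => .iUnion fun a => measurableSet_ball.prod (measurableSet_subset _)

section Volumes

variable {Ω' : Type*} [MeasurableSpace Ω'] {P' : Measure Ω'} [IsProbabilityMeasure P']
  {X : Ω' → Closeds Plane}

/-- The position `x` of a leaf is the reflection of the point at which the formulas with `X ⊕ Ǩ` and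
`X ⊖ Ǩ` look; the Lebesgue measure does not see the reflection. -/
theorem measure_prod_map_eq_lintegral (hX : Measurable X) {C : Set (Plane × Closeds Plane)}
    (hC : MeasurableSet C) :
    ((volume : Measure Plane).prod (P'.map X)) C =
      ∫⁻ ω, volume {x : Plane | (-x, X ω) ∈ C} ∂P' := by
  have := Measure.isProbabilityMeasure_map (μ := P') hX.aemeasurable
  rw [Measure.prod_apply_symm hC, lintegral_map (measurable_measure_prodMk_right hC) hX]
  refine lintegral_congr fun ω => ?_
  rw [← Measure.measure_neg]
  rfl

theorem neg_mem_hitSet_iff {x : Plane} {F : Closeds Plane} {K : Set Plane} :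
    (-x, F) ∈ hitSet K ↔ x ∈ (F : Set Plane) + -K := by
  simp only [hitSet, mem_ofPred_eq, Set.mem_add, Set.mem_neg]
  constructor
  · rintro ⟨k, hk, hkK⟩
    rw [mem_vadd_set_iff_neg_vadd_mem, neg_neg, vadd_eq_add] at hk
    exact ⟨x + k, hk, -k, by rwa [neg_neg], by abel⟩
  · rintro ⟨f, hf, k, hk, rfl⟩
    refine ⟨-k, ?_, hk⟩
    rw [mem_vadd_set_iff_neg_vadd_mem, neg_neg, vadd_eq_add]
    simpa using hf

theorem neg_mem_coverSet_iff {x : Plane} {F : Closeds Plane} {K : Set Plane} :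
    (-x, F) ∈ coverSet K ↔ x ∈ minkowskiDiff (interior (F : Set Plane)) (-K) := by
  simp only [coverSet, minkowskiDiff, mem_ofPred_eq, neg_neg]
  rw [vadd_set_subset_iff_subset_neg_vadd_set]

theorem measure_hitSet (hX : Measurable X) {K : Set Plane} (hK : IsCompact K) :
    ((volume : Measure Plane).prod (P'.map X)) (hitSet K) =
      ∫⁻ ω, volume ((X ω : Set Plane) + -K) ∂P' := by
  rw [measure_prod_map_eq_lintegral hX (measurableSet_hitSet hK)]
  refine lintegral_congr fun ω => congrArg volume ?_
  ext x
  exact neg_mem_hitSet_iff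

theorem measure_coverSet_diff_hitSet (hX : Measurable X) {K L : Set Plane} (hK : IsCompact K)
    (hL : IsCompact L) :
    ((volume : Measure Plane).prod (P'.map X)) (coverSet K \ hitSet L) =
      ∫⁻ ω, volume (minkowskiDiff (interior (X ω : Set Plane)) (-K) ∩
        ((X ω : Set Plane) + -L)ᶜ) ∂P' := by
  rw [measure_prod_map_eq_lintegral hX ((measurableSet_coverSet hK).diff (measurableSet_hitSet hL))]
  refine lintegral_congr fun ω => congrArg volume ?_
  ext x
  exact and_congr neg_mem_coverSet_iff (not_congr neg_mem_hitSet_iff)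

/-- If `x + (-D) ⊆ F`, a translate of `x` by a vector not depending on `x` lies in `F + K`. Hence
`E ν(X ⊖ D) > 0` makes the denominators positive. -/
theorem volume_minkowskiDiff_le {F D K : Set Plane} (hD : D.Nonempty) (hK : K.Nonempty) :
    volume (minkowskiDiff F D) ≤ volume (F + K) := by
  obtain ⟨c, hc⟩ := hD
  obtain ⟨k, hk⟩ := hK
  rw [← measure_vadd volume (-c + k)]
  refine measure_mono ?_
  rintro _ ⟨x, hx, rfl⟩
  refine Set.mem_add.2 ⟨x + -c, hx (vadd_mem_vadd_set (by simpa using hc)), k, hk, ?_⟩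
  simp only [vadd_eq_add]
  abel

end Volumes

/-! ### Visible parts and chains -/

/-- By local finiteness the closure of the union of the covering leaves is the union of their
closures, and the closure of the interior of a leaf is the leaf. -/
theorem interior_visiblePart {x : ℕ → Plane} {t : ℕ → ℝ} {X : ℕ → Closeds Plane}
    (hreg : ∀ i, (X i : Set Plane) = closure (interior (X i : Set Plane)))
    (hfin : ∀ R T : ℕ,
      {l | t l ∈ Ico (-(T : ℝ)) 0 ∧ (x l, X l) ∈ hitSet (Metric.closedBall 0 R)}.Finite) (i : ℕ) :
    interior (visiblePart x t X i) = (x i +ᵥ interior (X i : Set Plane)) \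
      ⋃ j ∈ {j : ℕ | t j ∈ Ioo (t i) 0}, (x j +ᵥ (X j : Set Plane)) := by
  have hlf : LocallyFinite fun j : {j : ℕ | t j ∈ Ioo (t i) 0} =>
      (x j +ᵥ interior (X j : Set Plane)) := by
    intro p
    obtain ⟨R, hR⟩ := exists_nat_gt ‖p‖
    obtain ⟨T, hT⟩ := exists_nat_ge (-t i)
    refine ⟨Metric.closedBall 0 R, ?_, ?_⟩
    · refine mem_of_superset (Metric.isOpen_ball.mem_nhds ?_) Metric.ball_subset_closedBall
      simpa using hR
    · refine ((hfin R T).preimage (f := Subtype.val) Subtype.val_injective.injOn).subset ?_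
      rintro ⟨j, hj⟩ hne
      refine ⟨⟨?_, hj.2⟩, hne.mono (inter_subset_inter_left _ (vadd_set_mono interior_subset))⟩
      have := hj.1
      linarith
  rw [visiblePart, sdiff_eq, interior_inter, interior_compl, ← sdiff_eq, interior_vadd, biUnion_eq_iUnion, biUnion_eq_iUnion,
    hlf.closure_iUnion]
  congr 1
  refine iUnion_congr fun j => ?_
  rw [closure_vadd, ← hreg]

/-- Times increasing from below to `s` at which the `j`-th point has its mark in `cov j` and is
followed before `s` by no mark in `hit j` form a backward chain, and conversely. -/
theorem backwardChain_iff_exists {S : Type*} {t : ℕ → ℝ} {y : ℕ → S} {cov hit : ℕ → Set S}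
    (htie : ∀ j i l, t i < 0 → y i ∈ cov j \ (⋃ k ∈ Iio j, hit k) →
      y l ∈ (⋃ k ∈ Iic j, hit k) \ (cov j \ ⋃ k ∈ Iio j, hit k) → t i ≠ t l)
    (n : ℕ) {s : ℝ} (hs : s ≤ 0) :
    backwardChain t y (fun j => ⋃ k ∈ Iic j, hit k) (fun j => cov j \ ⋃ k ∈ Iio j, hit k) n s ↔
      ∃ i : ℕ → ℕ, (∀ a b, a < b → b < n → t (i a) < t (i b)) ∧
        ∀ j < n, t (i j) < s ∧ y (i j) ∈ cov j ∧ ∀ l, t (i j) < t l → t l < s → y l ∉ hit j := by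
  induction n generalizing s with
  | zero => simp [backwardChain]
  | succ n ih =>
    constructor
    · rintro ⟨i₀, hi₀, hA, hgap, hchain⟩
      have hi0 : t i₀ < 0 := hi₀.trans_le hs
      obtain ⟨i, hmono, hi⟩ := (ih hi0.le).1 hchain
      have hlt : ∀ j < n, Function.update i n i₀ j = i j := fun j hj =>
        Function.update_of_ne hj.ne _ _
      have hn : Function.update i n i₀ n = i₀ := Function.update_self _ _ _
      refine ⟨Function.update i n i₀, fun a b hab hb => ?_, fun j hj => ?_⟩
      · rcases (Nat.lt_succ_iff.1 hb).eq_or_lt with rfl | hb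
        · rw [hlt a hab, hn]
          exact (hi a hab).1
        · rw [hlt a (hab.trans hb), hlt b hb]
          exact hmono a b hab hb
      · rcases (Nat.lt_succ_iff.1 hj).eq_or_lt with rfl | hj
        · rw [hn]
          exact ⟨hi₀, hA.1, fun l h1 h2 h3 => hgap l h1 h2 (mem_biUnion (mem_Iic.2 le_rfl) h3)⟩
        · rw [hlt j hj]
          refine ⟨(hi j hj).1.trans hi₀, (hi j hj).2.1, fun l h1 h2 h3 => ?_⟩
          rcases lt_trichotomy (t l) (t i₀) with h4 | h4 | h4
          · exact (hi j hj).2.2 l h1 h4 h3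
          · exact htie n i₀ l hi0 hA ⟨mem_biUnion (mem_Iic.2 hj.le) h3,
              fun h5 => h5.2 (mem_biUnion (mem_Iio.2 hj) h3)⟩ h4.symm
          · exact hgap l h4 h2 (mem_biUnion (mem_Iic.2 hj.le) h3)
    · rintro ⟨i, hmono, hi⟩
      obtain ⟨h1, h2, h3⟩ := hi n (Nat.lt_succ_self n)
      refine ⟨i n, h1, ⟨h2, fun h4 => ?_⟩, fun l hl hls h4 => ?_,
        (ih (h1.le.trans hs)).2 ⟨i, fun a b hab hb => hmono a b hab (hb.trans (Nat.lt_succ_self n)),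
          fun j hj => ⟨hmono j n hj (Nat.lt_succ_self n), (hi j (hj.trans (Nat.lt_succ_self n))).2.1,
            fun l hl hl' => (hi j (hj.trans (Nat.lt_succ_self n))).2.2 l hl (hl'.trans h1)⟩⟩⟩
      · obtain ⟨j, hj, h5⟩ := mem_iUnion₂.1 h4
        exact (hi j (hj.trans (Nat.lt_succ_self n))).2.2 (i n)
          (hmono j n hj (Nat.lt_succ_self n)) h1 h5
      · obtain ⟨j, hj, h5⟩ := mem_iUnion₂.1 h4
        refine (hi j (Nat.lt_succ_iff.2 hj)).2.2 l ?_ hls h5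
        rcases (mem_Iic.1 hj).eq_or_lt with rfl | hj
        · exact hl
        · exact (hmono j n hj (Nat.lt_succ_self n)).trans hl

/-! ### The dead leaves model -/

theorem IsMarkedProcess.ae_eq_closure_interior {Ω Ω' : Type*} [MeasurableSpace Ω]
    [MeasurableSpace Ω'] {P : Measure Ω} {P' : Measure Ω'} {X : Ω' → Closeds Plane}
    {x : ℕ → Ω → Plane} {t : ℕ → Ω → ℝ} {Xs : ℕ → Ω → Closeds Plane}
    (hΦ : IsMarkedProcess x t Xs P X P')
    (hreg : ∀ᵐ ω ∂P', (X ω : Set Plane) = closure (interior (X ω : Set Plane))) :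
    ∀ᵐ ω ∂P, ∀ i, (Xs i ω : Set Plane) = closure (interior (Xs i ω : Set Plane)) :=
  ae_all_iff.2 fun i => (hΦ.identDistrib_grain i).symm.ae_snd measurableSet_eq_closure_interior hreg

section Model

variable {Ω Ω' : Type*} [MeasurableSpace Ω] [MeasurableSpace Ω'] {P : Measure Ω}
  [IsProbabilityMeasure P] {P' : Measure Ω'} [IsProbabilityMeasure P']
  {X : Ω' → Closeds Plane} {x : ℕ → Ω → Plane} {t : ℕ → Ω → ℝ} {Xs : ℕ → Ω → Closeds Plane}

/-- The intensity of the leaves is preserved when a leaf is regarded as a time with the mark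
(position, grain). -/
theorem measurePreserving_timeFirst (Q : Measure (Closeds Plane)) [SFinite Q] :
    MeasurePreserving
      (fun p : (Plane × ℝ) × Closeds Plane => (p.1.2, (p.1.1, p.2)))
      ((volume : Measure (Plane × ℝ)).prod Q)
      ((volume : Measure ℝ).prod ((volume : Measure Plane).prod Q)) := by
  have h1 : MeasurePreserving (Prod.map Prod.swap id : (Plane × ℝ) × Closeds Plane → _)
      (((volume : Measure Plane).prod (volume : Measure ℝ)).prod Q)
      (((volume : Measure ℝ).prod (volume : Measure Plane)).prod Q) :=
    Measure.measurePreserving_swap.prod (MeasurePreserving.id Q)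
  exact (measurePreserving_prodAssoc (volume : Measure ℝ) (volume : Measure Plane) Q).comp h1

theorem IsMarkedProcess.measure_void (hΦ : IsMarkedProcess x t Xs P X P') (hX : Measurable X)
    {B : Set (ℝ × (Plane × Closeds Plane))} (hB : MeasurableSet B)
    (hBf : (volume.prod ((volume : Measure Plane).prod (P'.map X))) B ≠ ∞) :
    P {ω | ∀ i, (t i ω, (x i ω, Xs i ω)) ∉ B} = ENNReal.ofReal
      (Real.exp (-((volume.prod ((volume : Measure Plane).prod (P'.map X))) B).toReal)) := by
  have := Measure.isProbabilityMeasure_map (μ := P') hX.aemeasurable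
  have he := measurePreserving_timeFirst (P'.map X)
  rw [← he.measure_preimage hB.nullMeasurableSet] at hBf ⊢
  exact measure_forall_notMem_marked hΦ.poisson hΦ.measurable_grain hΦ.iIndep_grain
    (fun i => (hΦ.identDistrib_grain i).map_eq) hΦ.indep (he.measurable hB) hBf

/-- The leaves are locally finite with respect to their intensity `μ`: a region `B` with `μ B < ∞`
may be unbounded, but almost surely the leaves in it stay in a bounded part. -/
theorem IsMarkedProcess.hasPoissonVoids (hΦ : IsMarkedProcess x t Xs P X P')
    (hX : Measurable X) :
    HasPoissonVoids t (fun i ω => (x i ω, Xs i ω)) ((volume : Measure Plane).prod (P'.map X)) P where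
  measurable_time i := (hΦ.poisson.measurable i).snd
  measurable_mark i := (hΦ.poisson.measurable i).fst.prodMk (hΦ.measurable_grain i)
  measure_void _ hB hBf := hΦ.measure_void hX hB hBf
  ae_finite B hB hBf := by
    set μ := (volume : Measure ℝ).prod ((volume : Measure Plane).prod (P'.map X)) with hμ
    have := Measure.isProbabilityMeasure_map (μ := P') hX.aemeasurable
    -- Bounded regions hold finitely many leaves, and the part of `B` outside a large one is void
    -- with probability close to `1`.
    have hball : ∀ᵐ ω ∂P, ∀ R : ℕ,
        {i | (x i ω, t i ω) ∈ Metric.closedBall (0 : Plane × ℝ) R}.Finite :=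
      ae_all_iff.2 fun R => hΦ.poisson.ae_finite Metric.isClosed_closedBall.measurableSet
        (isCompact_closedBall _ _).measure_lt_top.ne
    set f : ℝ × (Plane × Closeds Plane) → Plane × ℝ := fun p => (p.2.1, p.1) with hf
    have hfm : Measurable f := measurable_snd.fst.prodMk measurable_fst
    set C : ℕ → Set (ℝ × (Plane × Closeds Plane)) := fun R =>
      B \ f ⁻¹' Metric.closedBall 0 R with hC
    have hCm : ∀ R, MeasurableSet (C R) := fun R =>
      hB.diff (hfm Metric.isClosed_closedBall.measurableSet)
    have hCf : ∀ R, μ (C R) ≠ ∞ := fun R => measure_ne_top_of_subset sdiff_subset hBf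
    have hCanti : Antitone C := fun R R' h =>
      sdiff_subset_sdiff_right (preimage_mono (Metric.closedBall_subset_closedBall
        (by exact_mod_cast h)))
    have hCinter : ⋂ R, C R = ∅ := by
      rw [eq_empty_iff_forall_notMem]
      intro p hp
      obtain ⟨R, hR⟩ := exists_nat_ge ‖f p‖
      exact (mem_iInter.1 hp R).2 (by simpa using hR)
    have hlim : Tendsto (fun R => μ (C R)) atTop (𝓝 0) := by
      have := tendsto_measure_iInter_atTop (μ := μ) (fun R => (hCm R).nullMeasurableSet) hCanti
        ⟨0, hCf 0⟩
      rwa [hCinter, measure_empty] at this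
    set V : ℕ → Set Ω := fun R => {ω | ∀ i, (t i ω, (x i ω, Xs i ω)) ∉ C R} with hV
    have hVm : ∀ R, MeasurableSet (V R) := by
      intro R
      have : V R = ⋂ i, (fun ω => (t i ω, (x i ω, Xs i ω))) ⁻¹' (C R)ᶜ := by
        ext ω; simp [hV]
      rw [this]
      exact .iInter fun i => ((hΦ.poisson.measurable i).snd.prodMk
        ((hΦ.poisson.measurable i).fst.prodMk (hΦ.measurable_grain i))) (hCm R).compl
    have hPV : Tendsto (fun R => P (V R)) atTop (𝓝 1) := by
      rw [show (fun R => P (V R)) = fun R => ENNReal.ofReal (Real.exp (-(μ (C R)).toReal)) from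
        funext fun R => hΦ.measure_void hX (hCm R) (hCf R)]
      have h1 := ENNReal.tendsto_ofReal ((Real.continuous_exp.tendsto _).comp
        ((ENNReal.tendsto_toReal ENNReal.zero_ne_top).comp hlim).neg)
      simpa using h1
    have hU : P (⋃ R, V R) = 1 :=
      le_antisymm prob_le_one (le_of_tendsto' hPV fun R => measure_mono (subset_iUnion V R))
    have hU' := (prob_compl_eq_zero_iff (MeasurableSet.iUnion hVm)).2 hU
    rw [← mem_ae_iff] at hU'
    filter_upwards [hball, hU'] with ω h1 h2
    obtain ⟨R, hR⟩ := mem_iUnion.1 h2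
    refine (h1 R).subset fun i hi => ?_
    by_contra hc
    exact hR i ⟨hi, hc⟩

/-- The formula for the sequential event, for a sequence of compact sets of which the first `n` are
used. Almost surely the event is a backward chain of length `n` from time `0`, with
`H j = {the leaf meets K₀ ∪ ⋯ ∪ Kⱼ}` and `A j = {Kⱼ lies in the interior of the leaf, which avoids
K₀ ∪ ⋯ ∪ Kⱼ₋₁}`. -/
theorem IsMarkedProcess.measure_sequentialEvent (hΦ : IsMarkedProcess x t Xs P X P')
    (hX : Measurable X)
    (hC1 : ∀ K : Set Plane, IsCompact K → ∫⁻ ω, volume ((X ω : Set Plane) + K) ∂P' < ∞)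
    (hC2 : ∃ (c : Plane) (r : ℝ), 0 < r ∧
      0 < ∫⁻ ω, volume (minkowskiDiff (X ω : Set Plane) (Metric.closedBall c r)) ∂P')
    (hreg : ∀ᵐ ω ∂P', (X ω : Set Plane) = closure (interior (X ω : Set Plane)))
    {K : ℕ → Set Plane} (hK : ∀ j, IsCompact (K j)) (hK0 : ∀ j, (K j).Nonempty) (n : ℕ) :
    NullMeasurableSet (sequentialEvent x t Xs fun j : Fin n => K j) P ∧
    P (sequentialEvent x t Xs fun j : Fin n => K j) =
      (∏ j ∈ Finset.range n, ∫⁻ ω, volume (minkowskiDiff (interior (X ω : Set Plane)) (-(K j)) ∩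
        ((X ω : Set Plane) + -(⋃ k ∈ Iio j, K k))ᶜ) ∂P') /
      ∏ j ∈ Finset.range n, ∫⁻ ω, volume ((X ω : Set Plane) + -(⋃ k ∈ Iic j, K k)) ∂P' := by
  have := Measure.isProbabilityMeasure_map (μ := P') hX.aemeasurable
  have hp := hΦ.hasPoissonVoids hX
  have hKc : ∀ j, IsCompact (⋃ k ∈ Iic j, K k) := fun j =>
    (finite_Iic j).isCompact_biUnion fun k _ => hK k
  have hKo : ∀ j, IsCompact (⋃ k ∈ Iio j, K k) := fun j =>
    (finite_Iio j).isCompact_biUnion fun k _ => hK k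
  have hHf : ∀ L : Set Plane, IsCompact L →
      ((volume : Measure Plane).prod (P'.map X)) (hitSet L) ≠ ∞ := fun L hL => by
    rw [measure_hitSet hX hL]
    exact (hC1 _ hL.neg).ne
  have hHm : ∀ j, MeasurableSet (⋃ k ∈ Iic j, hitSet (K k)) := fun j => by
    rw [← hitSet_biUnion]
    exact measurableSet_hitSet (hKc j)
  have hAm : ∀ j, MeasurableSet (coverSet (K j) \ ⋃ k ∈ Iio j, hitSet (K k)) := fun j => by
    rw [← hitSet_biUnion]
    exact (measurableSet_coverSet (hK j)).diff (measurableSet_hitSet (hKo j))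
  have hAH : ∀ j, (coverSet (K j) \ ⋃ k ∈ Iio j, hitSet (K k)) ⊆ ⋃ k ∈ Iic j, hitSet (K k) :=
    fun j p hp => mem_biUnion (mem_Iic.2 le_rfl) (coverSet_subset_hitSet (hK0 j) hp.1)
  have hHf' : ∀ j, ((volume : Measure Plane).prod (P'.map X)) (⋃ k ∈ Iic j, hitSet (K k)) ≠ ∞ :=
    fun j => by
      rw [← hitSet_biUnion]
      exact hHf _ (hKc j)
  have hH0 : ∀ j, ((volume : Measure Plane).prod (P'.map X)) (⋃ k ∈ Iic j, hitSet (K k)) ≠ 0 := by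
    intro j
    obtain ⟨c, r, hr, hpos⟩ := hC2
    rw [← hitSet_biUnion, measure_hitSet hX (hKc j)]
    refine (hpos.trans_le (lintegral_mono fun ω => ?_)).ne'
    refine volume_minkowskiDiff_le ⟨c, Metric.mem_closedBall_self hr.le⟩ ?_
    exact ((hK0 j).mono (subset_biUnion_of_mem (u := K) (mem_Iic.2 le_rfl))).neg
  have hmono : Monotone fun j => ⋃ k ∈ Iic j, hitSet (K k) := fun i j hij =>
    biUnion_subset_biUnion_left (Iic_subset_Iic.2 hij)
  have hdis : ∀ i j, i < j → Disjoint (coverSet (K j) \ ⋃ k ∈ Iio j, hitSet (K k))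
      (⋃ k ∈ Iic i, hitSet (K k)) := fun i j hij =>
    disjoint_sdiff_left.mono_right
      (biUnion_subset_biUnion_left fun k (hk : k ≤ i) => mem_Iio.2 (hk.trans_lt hij))
  obtain ⟨hnull, hprob⟩ := hp.measure_backwardChain hHm hAm hmono hAH hdis hHf' hH0 n
  have hfin : ∀ᵐ ω ∂P, ∀ R T : ℕ, {l | t l ω ∈ Ico (-(T : ℝ)) 0 ∧
      (x l ω, Xs l ω) ∈ hitSet (Metric.closedBall 0 R)}.Finite := by
    refine ae_all_iff.2 fun R => ae_all_iff.2 fun T => ?_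
    refine hp.ae_finite (Ico (-(T : ℝ)) 0 ×ˢ hitSet (Metric.closedBall 0 R))
      (measurableSet_Ico.prod (measurableSet_hitSet (isCompact_closedBall _ _))) ?_
    rw [Measure.prod_prod]
    exact ENNReal.mul_ne_top (by simp) (hHf _ (isCompact_closedBall _ _))
  have htie := ae_all_iff.2 fun j => hp.ae_time_ne_of_disjoint (hAm j) ((hHm j).diff (hAm j))
    (measure_ne_top_of_subset (hAH j) (hHf' j)) (measure_ne_top_of_subset sdiff_subset (hHf' j))
    disjoint_sdiff_right
  have hae : {ω | backwardChain (fun i => t i ω) (fun i => (x i ω, Xs i ω))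
      (fun j => ⋃ k ∈ Iic j, hitSet (K k)) (fun j => coverSet (K j) \ ⋃ k ∈ Iio j, hitSet (K k))
      n 0} =ᵐ[P] sequentialEvent x t Xs fun j : Fin n => K j := by
    filter_upwards [hfin, htie, hΦ.ae_eq_closure_interior hreg, hp.ae_time_ne 0] with ω h1 h2 h3 h4
    refine propext ((backwardChain_iff_exists h2 n le_rfl).trans ?_)
    have hvis : ∀ i j, K j ⊆ interior
        (visiblePart (fun l => x l ω) (fun l => t l ω) (fun l => Xs l ω) i) ↔
        (x i ω, Xs i ω) ∈ coverSet (K j) ∧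
          ∀ l, t i ω < t l ω → t l ω < 0 → (x l ω, Xs l ω) ∉ hitSet (K j) := by
      intro i j
      rw [interior_visiblePart h3 h1, subset_sdiff, disjoint_iUnion₂_right]
      refine and_congr Iff.rfl ⟨fun h l hl hl0 => ?_, fun h l hl => ?_⟩
      · exact Set.not_nonempty_iff_eq_empty.2
          (Set.disjoint_iff_inter_eq_empty.1 (h l ⟨hl, hl0⟩).symm)
      · exact (Set.disjoint_iff_inter_eq_empty.2
          (Set.not_nonempty_iff_eq_empty.1 (h l hl.1 hl.2))).symm
    constructor
    · rintro ⟨i, hi, hi'⟩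
      exact ⟨fun j => i j, fun a b hab => hi a b hab b.2, fun j => (hi' j j.2).1.le,
        fun j => (hvis _ _).2 (hi' j j.2).2⟩
    · rintro ⟨i, hi, hi0, hi'⟩
      have hneg : ∀ j, t (i j) ω < 0 := fun j => lt_of_le_of_ne (hi0 j) (h4 _)
      refine ⟨fun j => if h : j < n then i ⟨j, h⟩ else 0, fun a b hab hb => ?_, fun j hj => ?_⟩
      · simp only [hb, hab.trans hb, dif_pos]
        exact hi (show (⟨a, hab.trans hb⟩ : Fin n) < ⟨b, hb⟩ from hab)
      · simp only [hj, dif_pos]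
        exact ⟨hneg _, (hvis _ _).1 (hi' ⟨j, hj⟩)⟩
  refine ⟨hnull.congr hae, ?_⟩
  rw [← measure_congr hae, hprob]
  congr 1
  · refine Finset.prod_congr rfl fun j _ => ?_
    rw [← hitSet_biUnion, measure_coverSet_diff_hitSet hX (hK j) (hKo j)]
  · refine Finset.prod_congr rfl fun j _ => ?_
    rw [← hitSet_biUnion, measure_hitSet hX (hKc j)]

end Model

end DeadLeaves

theorem mainTheorem1 {Ω Ω' : Type*} [MeasurableSpace Ω] [MeasurableSpace Ω']
    (P : Measure Ω) [IsProbabilityMeasure P] (P' : Measure Ω') [IsProbabilityMeasure P']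
    (X : Ω' → Closeds DeadLeaves.Plane) (hX : Measurable X)
    (hC1 : ∀ K : Set DeadLeaves.Plane, IsCompact K →
      ∫⁻ ω, volume ((X ω : Set DeadLeaves.Plane) + K) ∂P' < ∞)
    (hC2 : ∃ (c : DeadLeaves.Plane) (r : ℝ), 0 < r ∧
      0 < ∫⁻ ω, volume (DeadLeaves.minkowskiDiff (X ω : Set DeadLeaves.Plane)
        (Metric.closedBall c r)) ∂P')
    (hreg : ∀ᵐ ω ∂P', (X ω : Set DeadLeaves.Plane) =
      closure (interior (X ω : Set DeadLeaves.Plane)))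
    (x : ℕ → Ω → DeadLeaves.Plane) (t : ℕ → Ω → ℝ) (Xs : ℕ → Ω → Closeds DeadLeaves.Plane)
    (hΦ : DeadLeaves.IsMarkedProcess x t Xs P X P') :
    (∀ (n : ℕ) (K : Fin n → Set DeadLeaves.Plane),
      (∀ j, IsCompact (K j)) → (∀ j, (K j).Nonempty) →
        NullMeasurableSet (DeadLeaves.sequentialEvent x t Xs K) P ∧
        P (DeadLeaves.sequentialEvent x t Xs K) =
          DeadLeaves.numerator X P' K / DeadLeaves.denominator X P' K) ∧
    (∀ K : Set DeadLeaves.Plane, IsCompact K → K.Nonempty →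
        NullMeasurableSet (DeadLeaves.inclusionEvent x t Xs K) P ∧
        P (DeadLeaves.inclusionEvent x t Xs K) =
          (∫⁻ ω, volume (DeadLeaves.minkowskiDiff
            (interior (X ω : Set DeadLeaves.Plane)) (-K)) ∂P') /
          ∫⁻ ω, volume ((X ω : Set DeadLeaves.Plane) + -K) ∂P') := by
  refine ⟨fun n K hK hK0 => ?_, fun K hK hK0 => ?_⟩
  · -- beyond `n` the sequence is continued by the arbitrary compact set `{0}`
    set K' : ℕ → Set DeadLeaves.Plane := fun j => if h : j < n then K ⟨j, h⟩ else {0} with hK'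
    have hval : ∀ j : Fin n, K' j = K j := fun j => by simp [hK', j.2]
    have hKc : ∀ j, IsCompact (K' j) := fun j => by
      by_cases h : j < n
      · simpa [hK', h] using hK ⟨j, h⟩
      · simp [hK', h]
    have hKn : ∀ j, (K' j).Nonempty := fun j => by
      by_cases h : j < n
      · simpa [hK', h] using hK0 ⟨j, h⟩
      · simp [hK', h]
    have hIio : ∀ j : Fin n, ⋃ k ∈ Iio (j : ℕ), K' k = ⋃ k ∈ Iio j, K k := by
      intro j
      ext p
      simp only [mem_iUnion, mem_Iio, exists_prop]
      constructor
      · rintro ⟨k, hk, hp⟩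
        exact ⟨⟨k, hk.trans j.2⟩, hk, by rwa [← hval]⟩
      · rintro ⟨k, hk, hp⟩
        exact ⟨k, hk, by rwa [hval]⟩
    have hIic : ∀ j : Fin n, ⋃ k ∈ Iic (j : ℕ), K' k = ⋃ k ∈ Iic j, K k := by
      intro j
      ext p
      simp only [mem_iUnion, mem_Iic, exists_prop]
      constructor
      · rintro ⟨k, hk, hp⟩
        exact ⟨⟨k, hk.trans_lt j.2⟩, hk, by rwa [← hval]⟩
      · rintro ⟨k, hk, hp⟩
        exact ⟨k, hk, by rwa [hval]⟩
    have h := hΦ.measure_sequentialEvent hX hC1 hC2 hreg hKc hKn n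
    rw [Finset.prod_range, Finset.prod_range] at h
    simp_rw [hval, hIio, hIic] at h
    exact h
  · have h := hΦ.measure_sequentialEvent hX hC1 hC2 hreg (fun _ => hK) (fun _ => hK0) 1
    have heq : DeadLeaves.sequentialEvent x t Xs (fun _ : Fin 1 => K) =
        DeadLeaves.inclusionEvent x t Xs K := by
      ext ω
      constructor
      · rintro ⟨i, -, h0, hi⟩
        exact ⟨i 0, h0 0, hi 0⟩
      · rintro ⟨i, h0, hi⟩
        exact ⟨fun _ => i, Subsingleton.strictMono _, fun _ => h0, fun _ => hi⟩
    rw [heq] at h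
    have hIic : ⋃ k ∈ Iic 0, K = K := by
      ext p; simp
    simpa using h
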